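/- For a finite set $V$ of qubits, a \emph{QAC circuit} of depth $d$ on $V$ is a product $L_dM_d\cdots L_1M_1L_0$, where each $L_k$ is a tensor product of arbitrary single-qubit unitaries and each $M_k$ is a layer of generalized $\mathrm{CZ}$ gates ($|x\rangle\mapsto-|x\rangle$ if all bits of $x$ on the support are $1$, and $|x\rangle\mapsto|x\rangle$ otherwise) with nonempty, pairwise disjoint supports. A \emph{$(w,\ell)$-2D-QAC circuit} is a QAC circuit whose qubits form a lattice with $w$ rows of length $\ell$ and in which the support of each $\mathrm{CZ}$ gate is a contiguous interval of qubits in one row or one column. A family $\{C_n\}_{n\in\mathbb N}$ of (2D-)QAC circuits is a \emph{(2D-)QAC$^0$ family} if its depth is bounded by a constant and its size (number of qubits) is bounded by a polynomial in $n$. Let $U_{\oplus_n}|x,b\rangle=|x,b\oplus x_1\oplus\cdots\oplus x_n\rangle$ for $x\in\{0,1\}^n$, $b\in\{0,1\}$. A circuit $C$ on $n+1+a$ qubits \emph{solves the $p$-approximate clean $U_{\oplus_n}$ problem} if for every $(n+1)$-qubit state $|\varphi\rangle$ the fidelity $|\langle\psi|\psi'\rangle|^2$ of $|\psi\rangle=C(|\varphi\rangle\otimes|0^a\rangle)$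 and $|\psi'\rangle=(U_{\oplus_n}|\varphi\rangle)\otimes|0^a\rangle$ is at least $p$. It \emph{exactly implements} $U_{\oplus_n}$ if $C(|\varphi\rangle\otimes|0^a\rangle)=(U_{\oplus_n}|\varphi\rangle)\otimes|0^a\rangle$ for every $|\varphi\rangle$. In a 2D-QAC circuit the $n+1$ input and target qubits may sit at any fixed distinct lattice sites, and all the other sites are ancillas. \textbf{Theorem.} Let $p>\tfrac12$ be a constant and suppose that there is a QAC$^0$ family $\{C_n\}_{n\in\mathbb N}$ such that, for every $n$, $C_n$ solves the $p$-approximate clean $U_{\oplus_n}$ problem. Then for every constant $\varepsilon>0$ there is a 2D-QAC$^0$ family $\{D_n\}_{n\in\mathbb N}$ (whose depth bound may depend on $\varepsilon$) such that $D_n$ exactly implements $U_{\oplus_n}$ for every $n$, and for all sufficiently large $n$ the circuit $D_n$ lives on a lattice with $\lfloor n^{\varepsilon}\rfloor$ rows of length $\lfloor n^{1+\varepsilon}\rfloor$. -/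

import Mathlib

/-! ### Qubit registers

A register of qubits is indexed by a finite type `V`; its computational basis is `V → Bool`
(`true` is the bit `1`), and its state vectors are the functions `(V → Bool) → ℂ`. -/

/-- `ψ` is a (normalized) pure state of the register `V`. -/
def IsPureState {V : Type} [Fintype V] [DecidableEq V] (ψ : (V → Bool) → ℂ) : Prop :=
  ∑ x, ‖ψ x‖ ^ 2 = 1

/-- The fidelity `|⟨ψ|φ⟩|²` of two pure states. -/
noncomputable def pureFidelity {V : Type} [Fintype V] [DecidableEq V]
    (ψ φ : (V → Bool) → ℂ) : ℝ :=
  ‖star ψ ⬝ᵥ φ‖ ^ 2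

/-- The state `|φ⟩ ⊗ |0…0⟩` of the register `V`: the state `φ` is placed on the qubits
`ι i`, `i : W`, and all the other qubits (the ancillas) are in the state `|0⟩`. -/
noncomputable def withAncilla {V W : Type} [Fintype V] [DecidableEq V] [Fintype W]
    [DecidableEq W] (ι : W ↪ V) (φ : (W → Bool) → ℂ) : (V → Bool) → ℂ :=
  fun x => open Classical in
    if ∀ v, v ∉ Set.range ι → x v = false then φ (fun i => x (ι i)) else 0

/-! ### QAC circuits -/

/-- A layer of (generalized) `CZ` gates, given by their supports: nonempty, pairwise disjoint
sets of qubits. -/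
structure CZLayer (V : Type) [DecidableEq V] where
  supports : Finset (Finset V)
  nonempty : ∀ S ∈ supports, S.Nonempty
  disjoint : (supports : Set (Finset V)).PairwiseDisjoint id

/-- The unitary of a layer of `CZ` gates: a basis state `|x⟩` picks up a factor `-1` for every
gate on whose support `x` is constantly `1`. -/
noncomputable def CZLayer.toMatrix {V : Type} [Fintype V] [DecidableEq V] (M : CZLayer V) :
    Matrix (V → Bool) (V → Bool) ℂ :=
  Matrix.diagonal fun x => ∏ S ∈ M.supports, if ∀ v ∈ S, x v = true then (-1 : ℂ) else 1

/-- The tensor product of one single-qubit unitary for every qubit. -/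
noncomputable def singleQubitLayer {V : Type} [Fintype V] [DecidableEq V]
    (L : V → Matrix.unitaryGroup Bool ℂ) : Matrix (V → Bool) (V → Bool) ℂ :=
  Matrix.of fun x y => ∏ v, (L v : Matrix Bool Bool ℂ) (x v) (y v)

/-- A QAC circuit `L_d M_d ⋯ L_1 M_1 L_0` on the qubits `V`: `init` is the layer `L_0` of
single-qubit unitaries, and `rounds` lists the pairs `(M_1, L_1), …, (M_d, L_d)` of a layer of
`CZ` gates followed by a layer of single-qubit unitaries. -/
structure QACCircuit (V : Type) [DecidableEq V] where
  init : V → Matrix.unitaryGroup Bool ℂ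
  rounds : List (CZLayer V × (V → Matrix.unitaryGroup Bool ℂ))

/-- The depth of a QAC circuit: the number of `CZ` layers. -/
def QACCircuit.depth {V : Type} [DecidableEq V] (C : QACCircuit V) : ℕ := C.rounds.length

/-- The unitary computed by a QAC circuit. -/
noncomputable def QACCircuit.toMatrix {V : Type} [Fintype V] [DecidableEq V]
    (C : QACCircuit V) : Matrix (V → Bool) (V → Bool) ℂ :=
  C.rounds.foldl (fun A r => singleQubitLayer r.2 * (r.1.toMatrix * A))
    (singleQubitLayer C.init)

/-- `C` solves the `p`-approximate clean `U` problem, the register of `U` being placed on the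
qubits of `C` by `ι`: for every input state `φ`, the fidelity of `C |φ, 0…0⟩` and
`(U |φ⟩) ⊗ |0…0⟩` is at least `p`. -/
def SolvesApproxClean {V W : Type} [Fintype V] [DecidableEq V] [Fintype W] [DecidableEq W]
    (p : ℝ) (C : QACCircuit V) (ι : W ↪ V) (U : Matrix (W → Bool) (W → Bool) ℂ) : Prop :=
  ∀ φ : (W → Bool) → ℂ, IsPureState φ →
    p ≤ pureFidelity (C.toMatrix.mulVec (withAncilla ι φ)) (withAncilla ι (U.mulVec φ))

/-- `C` exactly implements `U`, the register of `U` being placed on the qubits of `C` by `ι`: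
`C |φ, 0…0⟩ = (U |φ⟩) ⊗ |0…0⟩` for every input state `φ`. -/
def ExactlyImplements {V W : Type} [Fintype V] [DecidableEq V] [Fintype W] [DecidableEq W]
    (C : QACCircuit V) (ι : W ↪ V) (U : Matrix (W → Bool) (W → Bool) ℂ) : Prop :=
  ∀ φ : (W → Bool) → ℂ, IsPureState φ →
    C.toMatrix.mulVec (withAncilla ι φ) = withAncilla ι (U.mulVec φ)

/-! ### The parity unitary -/

/-- The parity `x_1 ⊕ ⋯ ⊕ x_n`. -/
def parityBit {n : ℕ} (x : Fin n → Bool) : Bool :=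
  decide (Odd (Finset.univ.filter fun i => x i = true).card)

/-- The unitary `|x, b⟩ ↦ |x, b ⊕ x_1 ⊕ ⋯ ⊕ x_n⟩` on `n + 1` qubits: `Sum.inl i` is the `i`-th
input qubit and `Sum.inr ()` is the target qubit. -/
def parityUnitary (n : ℕ) : Matrix (Fin n ⊕ Unit → Bool) (Fin n ⊕ Unit → Bool) ℂ :=
  Matrix.of fun y z =>
    if y = Sum.elim (fun i => z (Sum.inl i))
        (fun _ => xor (z (Sum.inr ())) (parityBit fun i => z (Sum.inl i)))
    then 1 else 0

/-! ### Circuit families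

The `n`-th circuit acts on the `n + 1` qubits of the parity unitary and on ancillas. The supports
in a layer are nonempty and disjoint, so in constant depth the number of gates is polynomial as
soon as the number of qubits is. -/

/-- A QAC⁰ family: constant depth and polynomial size. -/
structure QAC0Family where
  ancillas : ℕ → ℕ
  circuit : (n : ℕ) → QACCircuit ((Fin n ⊕ Unit) ⊕ Fin (ancillas n))
  const_depth : ∃ d : ℕ, ∀ n, (circuit n).depth ≤ d
  poly_size : ∃ c : ℕ, ∀ n, ancillas n ≤ n ^ c + c

/-- A contiguous interval of qubits in one row or in one column of a `w × l` lattice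
(`w` rows of length `l`). -/
def IsLineInterval {w l : ℕ} (S : Finset (Fin w × Fin l)) : Prop :=
  (∃ (i : Fin w) (a b : Fin l), S = {i} ×ˢ Finset.Icc a b) ∨
  (∃ (a b : Fin w) (j : Fin l), S = Finset.Icc a b ×ˢ {j})

/-- A QAC circuit on a `w × l` lattice is a 2D-QAC circuit if each of its `CZ` gates acts on a
contiguous interval of qubits in one row or in one column. -/
def QACCircuit.IsTwoDim {w l : ℕ} (C : QACCircuit (Fin w × Fin l)) : Prop :=
  ∀ r ∈ C.rounds, ∀ S ∈ r.1.supports, IsLineInterval S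

/-- A 2D-QAC⁰ family: 2D-QAC circuits of constant depth and polynomial size. The `n`-th circuit
lives on `rows n` rows of length `cols n`; `position n` says at which (distinct) lattice sites the
`n` input qubits and the target qubit are. All the other sites are ancillas. -/
structure TwoDimQAC0Family where
  rows : ℕ → ℕ
  cols : ℕ → ℕ
  circuit : (n : ℕ) → QACCircuit (Fin (rows n) × Fin (cols n))
  position : (n : ℕ) → (Fin n ⊕ Unit) ↪ (Fin (rows n) × Fin (cols n))
  two_dim : ∀ n, (circuit n).IsTwoDim
  const_depth : ∃ d : ℕ, ∀ n, (circuit n).depth ≤ d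
  poly_size : ∃ c : ℕ, ∀ n, rows n * cols n ≤ n ^ c + c

/-!
Conjugating an approximate clean parity circuit by Hadamards gives a circuit that takes `|0…0⟩` to
a state whose amplitudes at `|0…0⟩` and `|1…1⟩|0…0⟩` have absolute value at least `√(2p) - 1`. Two
flag qubits equalise these amplitudes and lower them so that the overlap with the cat state becomes
`sin (π / (2 * (2 * j + 1)))` for some constant `j`, after which `j` rounds of Grover amplification
rotate onto the cat state exactly. Kicking the phases `(-1) ^ xᵢ` of the inputs back onto the qubits
of the cat state and then uncomputing the cat state yields an exact parity circuit of constant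
depth.

A circuit on `N` qubits embeds in an `N × (N + 1)` lattice with the qubits in one column: each gate
gets a column of its own, to which the qubits of the gate are copied along their rows. A parity of
`m ^ (k + 1)` bits is a tree of `m`-ary parities, and such lattices placed side by side use only
`poly(m)` rows, which is at most `n ^ ε` when `m ≈ n ^ (1 / (k + 1))` and `k` is large.
-/

open scoped Matrix

/-! ### Layers of a circuit -/

/-- The computational basis state `|x⟩`. -/
noncomputable def ket {V : Type} [Fintype V] [DecidableEq V] (x : V → Bool) :
    (V → Bool) → ℂ :=
  Pi.single x 1

section Layers

variable {V : Type} [Fintype V] [DecidableEq V]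

theorem ket_apply (x y : V → Bool) : ket x y = if y = x then 1 else 0 := by
  simp only [ket, Pi.single_apply]

theorem ket_apply_self (x : V → Bool) : ket x x = 1 := Pi.single_eq_same x 1

theorem ket_apply_of_ne {x y : V → Bool} (h : y ≠ x) : ket x y = 0 := Pi.single_eq_of_ne h 1

theorem mulVec_ket {m : Type} (A : Matrix m (V → Bool) ℂ) (x : V → Bool) (y : m) :
    (A *ᵥ ket x) y = A y x := by
  simp [ket]

theorem matrix_ext_ket {m : Type} {A B : Matrix m (V → Bool) ℂ}
    (h : ∀ x, A *ᵥ ket x = B *ᵥ ket x) : A = B := by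
  ext y x
  simpa only [mulVec_ket] using congrFun (h x) y

theorem diagonal_mulVec_ket (f : (V → Bool) → ℂ) (x : V → Bool) :
    Matrix.diagonal f *ᵥ ket x = f x • ket x := by
  rw [ket, Matrix.diagonal_mulVec_single, mul_one, ← Pi.single_smul, smul_eq_mul, mul_one]

theorem singleQubitLayer_mulVec_ket (L : V → Matrix.unitaryGroup Bool ℂ) (x y : V → Bool) :
    (singleQubitLayer L *ᵥ ket x) y = ∏ v, (L v : Matrix Bool Bool ℂ) (y v) (x v) :=
  mulVec_ket _ x y

theorem singleQubitLayer_mul (L L' : V → Matrix.unitaryGroup Bool ℂ) :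
    singleQubitLayer (fun v => L v * L' v) = singleQubitLayer L * singleQubitLayer L' := by
  ext x z
  simp only [singleQubitLayer, Matrix.of_apply, Matrix.mul_apply, Submonoid.coe_mul,
    ← Finset.prod_mul_distrib]
  rw [Finset.prod_univ_sum, Fintype.piFinset_univ]

theorem singleQubitLayer_one :
    singleQubitLayer (fun _ : V => (1 : Matrix.unitaryGroup Bool ℂ)) = 1 := by
  ext x y
  simp only [singleQubitLayer, Matrix.of_apply, OneMemClass.coe_one, Matrix.one_apply,
    Finset.prod_ite_zero, Finset.prod_const_one, funext_iff, Finset.mem_univ, true_imp_iff]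

theorem singleQubitLayer_conjTranspose (L : V → Matrix.unitaryGroup Bool ℂ) :
    (singleQubitLayer L)ᴴ = singleQubitLayer fun v => (L v)⁻¹ := by
  ext x y
  simp [singleQubitLayer, Matrix.conjTranspose_apply, Matrix.star_apply]

theorem singleQubitLayer_mem_unitaryGroup (L : V → Matrix.unitaryGroup Bool ℂ) :
    singleQubitLayer L ∈ Matrix.unitaryGroup (V → Bool) ℂ := by
  rw [Matrix.mem_unitaryGroup_iff', Matrix.star_eq_conjTranspose, singleQubitLayer_conjTranspose,
    ← singleQubitLayer_mul]
  simp only [inv_mul_cancel, singleQubitLayer_one]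

/-- The sign picked up by the basis state `|x⟩` in a layer of `CZ` gates. -/
noncomputable def CZLayer.sign (M : CZLayer V) (x : V → Bool) : ℂ :=
  ∏ S ∈ M.supports, if ∀ v ∈ S, x v = true then (-1 : ℂ) else 1

theorem CZLayer.toMatrix_eq_diagonal (M : CZLayer V) : M.toMatrix = Matrix.diagonal M.sign := rfl

theorem CZLayer.sign_mul_self (M : CZLayer V) (x : V → Bool) : M.sign x * M.sign x = 1 := by
  rw [CZLayer.sign, ← Finset.prod_mul_distrib]
  exact Finset.prod_eq_one fun S _ => by split_ifs <;> norm_num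

theorem CZLayer.star_sign (M : CZLayer V) (x : V → Bool) : star (M.sign x) = M.sign x := by
  rw [CZLayer.sign, star_prod]
  exact Finset.prod_congr rfl fun S _ => by split_ifs <;> simp

theorem CZLayer.conjTranspose_toMatrix (M : CZLayer V) : M.toMatrixᴴ = M.toMatrix := by
  rw [M.toMatrix_eq_diagonal, Matrix.diagonal_conjTranspose]
  exact congrArg _ (funext M.star_sign)

theorem CZLayer.toMatrix_mul_self (M : CZLayer V) : M.toMatrix * M.toMatrix = 1 := by
  simp only [M.toMatrix_eq_diagonal, Matrix.diagonal_mul_diagonal, M.sign_mul_self,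
    Matrix.diagonal_one]

theorem CZLayer.toMatrix_mem_unitaryGroup (M : CZLayer V) :
    M.toMatrix ∈ Matrix.unitaryGroup (V → Bool) ℂ := by
  rw [Matrix.mem_unitaryGroup_iff', Matrix.star_eq_conjTranspose, M.conjTranspose_toMatrix,
    M.toMatrix_mul_self]

section Family

variable {I : Type} [Fintype I] {S : I → Finset V}

/-- The layer of `CZ` gates given by an indexed family of disjoint supports. -/
def CZLayer.ofFamily (S : I → Finset V) (hS : ∀ i, (S i).Nonempty)
    (hd : Pairwise (Function.onFun Disjoint S)) : CZLayer V where
  supports := Finset.univ.image S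
  nonempty := by simpa using hS
  disjoint := by
    rw [Finset.coe_image, Finset.coe_univ, Set.image_univ]
    rintro _ ⟨i, rfl⟩ _ ⟨j, rfl⟩ hij
    exact hd fun h => hij (congrArg S h)

omit [Fintype V] in
theorem CZLayer.forall_mem_supports_ofFamily {hS : ∀ i, (S i).Nonempty}
    {hd : Pairwise (Function.onFun Disjoint S)} {P : Finset V → Prop} :
    (∀ T ∈ (CZLayer.ofFamily S hS hd).supports, P T) ↔ ∀ i, P (S i) := by
  simp [CZLayer.ofFamily]

theorem CZLayer.sign_ofFamily (hS : ∀ i, (S i).Nonempty)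
    (hd : Pairwise (Function.onFun Disjoint S)) (x : V → Bool) :
    (CZLayer.ofFamily S hS hd).sign x =
      ∏ i, if ∀ v ∈ S i, x v = true then (-1 : ℂ) else 1 := by
  have hinj : Function.Injective S := fun i j hij => by
    by_contra hne
    have h : Disjoint (S i) (S j) := hd hne
    rw [← hij, Finset.disjoint_self_iff_empty] at h
    exact (hS i).ne_empty h
  rw [CZLayer.sign, CZLayer.ofFamily, Finset.prod_image fun i _ j _ hij => hinj hij]

end Family

end Layers

section Unitary

variable {n : Type} [Fintype n] [DecidableEq n] {A : Matrix n n ℂ}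

theorem conjTranspose_mulVec_mulVec_of_unitary (hA : A ∈ Matrix.unitaryGroup n ℂ) (φ : n → ℂ) :
    Aᴴ *ᵥ (A *ᵥ φ) = φ := by
  rw [Matrix.mulVec_mulVec, ← Matrix.star_eq_conjTranspose, Matrix.mem_unitaryGroup_iff'.1 hA,
    Matrix.one_mulVec]

theorem mulVec_conjTranspose_mulVec_of_unitary (hA : A ∈ Matrix.unitaryGroup n ℂ) (φ : n → ℂ) :
    A *ᵥ (Aᴴ *ᵥ φ) = φ := by
  rw [Matrix.mulVec_mulVec, ← Matrix.star_eq_conjTranspose, Matrix.mem_unitaryGroup_iff.1 hA,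
    Matrix.one_mulVec]

theorem star_mulVec_dotProduct_mulVec_of_unitary (hA : A ∈ Matrix.unitaryGroup n ℂ)
    (φ χ : n → ℂ) : star (A *ᵥ φ) ⬝ᵥ A *ᵥ χ = star φ ⬝ᵥ χ := by
  rw [Matrix.star_mulVec, ← Matrix.dotProduct_mulVec, conjTranspose_mulVec_mulVec_of_unitary hA]

end Unitary

/-! ### Unitaries realized in a given depth -/

/-- `A` is computed by a circuit with `d` layers of `CZ` gates, all of whose supports
satisfy `P`. Unlike for `QACCircuit`, the single-qubit layers may be repeated or missing, which
makes the notion stable under products and adjoints. -/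
inductive Realizes {V : Type} [Fintype V] [DecidableEq V] (P : Finset V → Prop) :
    ℕ → Matrix (V → Bool) (V → Bool) ℂ → Prop
  | single (L : V → Matrix.unitaryGroup Bool ℂ) : Realizes P 0 (singleQubitLayer L)
  | cz (M : CZLayer V) (h : ∀ S ∈ M.supports, P S) : Realizes P 1 M.toMatrix
  | mul {d₁ d₂ : ℕ} {A B : Matrix (V → Bool) (V → Bool) ℂ} (hA : Realizes P d₁ A)
      (hB : Realizes P d₂ B) : Realizes P (d₁ + d₂) (A * B)

namespace Realizes

variable {V : Type} [Fintype V] [DecidableEq V] {P : Finset V → Prop} {d : ℕ}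
  {A : Matrix (V → Bool) (V → Bool) ℂ}

theorem one : Realizes P 0 1 := by
  rw [← singleQubitLayer_one]
  exact .single _

theorem one_of_emptyLayer : Realizes P 1 1 := by
  have h := Realizes.cz (P := P) (⟨∅, by simp, by simp⟩ : CZLayer V) (by simp)
  rwa [show (⟨∅, by simp, by simp⟩ : CZLayer V).toMatrix = 1 by simp [CZLayer.toMatrix]] at h

theorem mono {d' : ℕ} (h : Realizes P d A) (hd : d ≤ d') : Realizes P d' A := by
  induction d', hd using Nat.le_induction with
  | base => exact h
  | succ k _ ih => simpa only [mul_one] using ih.mul one_of_emptyLayer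

theorem conjTranspose (h : Realizes P d A) : Realizes P d Aᴴ := by
  induction h with
  | single L => rw [singleQubitLayer_conjTranspose]; exact .single _
  | cz M h => rw [M.conjTranspose_toMatrix]; exact .cz M h
  | mul _ _ h₁ h₂ => rw [Matrix.conjTranspose_mul, add_comm]; exact h₂.mul h₁

theorem mem_unitaryGroup (h : Realizes P d A) : A ∈ Matrix.unitaryGroup (V → Bool) ℂ := by
  induction h with
  | single L => exact singleQubitLayer_mem_unitaryGroup L
  | cz M _ => exact M.toMatrix_mem_unitaryGroup
  | mul _ _ h₁ h₂ => exact mul_mem h₁ h₂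

end Realizes

namespace QACCircuit

variable {V : Type} [Fintype V] [DecidableEq V]

theorem toMatrix_append (L₀ : V → Matrix.unitaryGroup Bool ℂ)
    (rs : List (CZLayer V × (V → Matrix.unitaryGroup Bool ℂ)))
    (r : CZLayer V × (V → Matrix.unitaryGroup Bool ℂ)) :
    toMatrix ⟨L₀, rs ++ [r]⟩ = singleQubitLayer r.2 * (r.1.toMatrix * toMatrix ⟨L₀, rs⟩) := by
  simp only [toMatrix, List.foldl_append, List.foldl_cons, List.foldl_nil]

theorem realizes (C : QACCircuit V) : Realizes (fun _ => True) C.depth C.toMatrix := by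
  obtain ⟨L₀, rs⟩ := C
  induction rs using List.reverseRecOn with
  | nil => exact .single L₀
  | append_singleton rs r ih =>
    rw [toMatrix_append]
    refine ((Realizes.single r.2).mul ((Realizes.cz r.1 (by simp)).mul ih)).mono ?_
    simp only [depth, List.length_append, List.length_singleton]
    omega

variable {P : Finset V → Prop}

theorem exists_single_mul (L : V → Matrix.unitaryGroup Bool ℂ) (C : QACCircuit V)
    (hC : ∀ r ∈ C.rounds, ∀ S ∈ r.1.supports, P S) :
    ∃ C' : QACCircuit V, (∀ r ∈ C'.rounds, ∀ S ∈ r.1.supports, P S) ∧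
      C'.depth = C.depth ∧ C'.toMatrix = singleQubitLayer L * C.toMatrix := by
  obtain ⟨L₀, rs⟩ := C
  rcases List.eq_nil_or_concat' rs with rfl | ⟨rs, r, rfl⟩
  · exact ⟨⟨fun v => L v * L₀ v, []⟩, by simp, rfl, singleQubitLayer_mul L L₀⟩
  · refine ⟨⟨L₀, rs ++ [(r.1, fun v => L v * r.2 v)]⟩, ?_, by simp [depth], ?_⟩
    · simpa [or_imp, forall_and] using hC
    · simp only [toMatrix_append, singleQubitLayer_mul, Matrix.mul_assoc]

theorem exists_cz_mul (M : CZLayer V) (hM : ∀ S ∈ M.supports, P S) (C : QACCircuit V)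
    (hC : ∀ r ∈ C.rounds, ∀ S ∈ r.1.supports, P S) :
    ∃ C' : QACCircuit V, (∀ r ∈ C'.rounds, ∀ S ∈ r.1.supports, P S) ∧
      C'.depth = 1 + C.depth ∧ C'.toMatrix = M.toMatrix * C.toMatrix := by
  obtain ⟨L₀, rs⟩ := C
  refine ⟨⟨L₀, rs ++ [(M, fun _ => 1)]⟩, fun r hr => ?_, by simp [depth, add_comm], ?_⟩
  · rcases List.mem_append.1 hr with hr | hr
    · exact hC r hr
    · rw [List.mem_singleton.1 hr]
      exact hM
  · rw [toMatrix_append, singleQubitLayer_one, Matrix.one_mul]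

end QACCircuit

namespace Realizes

variable {V : Type} [Fintype V] [DecidableEq V] {P : Finset V → Prop} {d : ℕ}
  {A : Matrix (V → Bool) (V → Bool) ℂ}

theorem exists_circuit_mul (h : Realizes P d A) :
    ∀ C : QACCircuit V, (∀ r ∈ C.rounds, ∀ S ∈ r.1.supports, P S) →
      ∃ C' : QACCircuit V, (∀ r ∈ C'.rounds, ∀ S ∈ r.1.supports, P S) ∧
        C'.depth = d + C.depth ∧ C'.toMatrix = A * C.toMatrix := by
  induction h with
  | single L => simpa only [zero_add] using QACCircuit.exists_single_mul L
  | cz M h => exact QACCircuit.exists_cz_mul M h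
  | mul _ _ h₁ h₂ =>
    intro C hC
    obtain ⟨C₂, hP₂, hd₂, hm₂⟩ := h₂ C hC
    obtain ⟨C₁, hP₁, hd₁, hm₁⟩ := h₁ C₂ hP₂
    exact ⟨C₁, hP₁, by omega, by rw [hm₁, hm₂, Matrix.mul_assoc]⟩

theorem exists_circuit (h : Realizes P d A) :
    ∃ C : QACCircuit V, (∀ r ∈ C.rounds, ∀ S ∈ r.1.supports, P S) ∧
      C.depth = d ∧ C.toMatrix = A := by
  obtain ⟨C, hP, hd, hm⟩ := h.exists_circuit_mul ⟨fun _ => 1, []⟩ (by simp)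
  refine ⟨C, hP, hd, ?_⟩
  rw [hm, show QACCircuit.toMatrix ⟨fun _ => 1, []⟩ = 1 from singleQubitLayer_one, mul_one]

end Realizes

/-! ### Subregisters -/

section Subregister

variable {J V' : Type} (e : J ↪ V')

theorem extend_apply_of_notMem_range {β : Type} (x : J → β) (ρ : V' → β) {v : V'}
    (hv : v ∉ Set.range e) : Function.extend e x ρ v = ρ v :=
  Function.extend_apply' _ _ _ hv

theorem eq_extend_iff {β : Type} {x : J → β} {ρ z : V' → β} :
    z = Function.extend e x ρ ↔ (∀ u, z (e u) = x u) ∧ ∀ v, v ∉ Set.range e → z v = ρ v := by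
  constructor
  · rintro rfl
    exact ⟨e.injective.extend_apply x ρ, fun v => extend_apply_of_notMem_range e x ρ⟩
  · rintro ⟨hmem, hnotMem⟩
    ext v
    by_cases hv : v ∈ Set.range e
    · obtain ⟨u, rfl⟩ := hv
      rw [hmem, e.injective.extend_apply]
    · rw [hnotMem v hv, extend_apply_of_notMem_range e x ρ hv]

theorem update_extend [DecidableEq J] [DecidableEq V'] {β : Type} (x : J → β) (ρ : V' → β)
    (u : J) (b : β) : Function.update (Function.extend e x ρ) (e u) b =
      Function.extend e (Function.update x u b) ρ := by
  refine (eq_extend_iff e).2 ⟨fun v => ?_, fun v hv => ?_⟩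
  · simp only [Function.update_apply, e.injective.eq_iff, e.injective.extend_apply]
  · rw [Function.update_of_ne fun h => hv ⟨u, h.symm⟩, extend_apply_of_notMem_range e x ρ hv]

theorem eq_of_eqOn_range {β : Type} {x y : V' → β} (hmem : ∀ u, x (e u) = y (e u))
    (hnotMem : ∀ v, v ∉ Set.range e → x v = y v) : x = y := by
  ext v
  by_cases hv : v ∈ Set.range e
  · obtain ⟨u, rfl⟩ := hv
    exact hmem u
  · exact hnotMem v hv

theorem sum_eq_sum_extend [Fintype J] [DecidableEq J] [Fintype V'] [DecidableEq V']
    {M : Type} [AddCommMonoid M] (ρ : V' → Bool) (f : (V' → Bool) → M)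
    (hf : ∀ y, ¬ (∀ v, v ∉ Set.range e → ρ v = y v) → f y = 0) :
    ∑ y, f y = ∑ q : J → Bool, f (Function.extend e q ρ) := by
  refine (Fintype.sum_of_injective (fun q => Function.extend e q ρ)
    (Function.extend_injective e.injective ρ) _ _ (fun y hy => hf y fun h => hy ?_)
    fun _ => rfl).symm
  exact ⟨fun u => y (e u), ((eq_extend_iff e).2 ⟨fun _ => rfl, fun v hv => (h v hv).symm⟩).symm⟩

end Subregister

/-! ### Parallel copies of a unitary -/

section Parallel

variable {I V V' : Type} [Fintype I]

/-- The unitary that acts as `A` on each of the disjoint registers `e (i, ·)` and as the identity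
on the other qubits. -/
noncomputable def parallel (e : I × V ↪ V') (A : Matrix (V → Bool) (V → Bool) ℂ) :
    Matrix (V' → Bool) (V' → Bool) ℂ :=
  Matrix.of fun x y => open Classical in
    if ∀ v, v ∉ Set.range e → x v = y v
      then ∏ i, A (fun v => x (e (i, v))) (fun v => y (e (i, v))) else 0

theorem parallel_apply_of_agree (e : I × V ↪ V') (A : Matrix (V → Bool) (V → Bool) ℂ)
    {x y : V' → Bool} (h : ∀ v, v ∉ Set.range e → x v = y v) :
    parallel e A x y = ∏ i, A (fun v => x (e (i, v))) (fun v => y (e (i, v))) :=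
  if_pos h

theorem parallel_apply_of_not_agree (e : I × V ↪ V') (A : Matrix (V → Bool) (V → Bool) ℂ)
    {x y : V' → Bool} (h : ¬ ∀ v, v ∉ Set.range e → x v = y v) : parallel e A x y = 0 :=
  if_neg h

variable [Fintype V] [DecidableEq V] [Fintype V'] [DecidableEq V']

theorem parallel_mul (e : I × V ↪ V') (A B : Matrix (V → Bool) (V → Bool) ℂ) :
    parallel e (A * B) = parallel e A * parallel e B := by
  classical
  ext x z
  have agree (q : I × V → Bool) (v) (hv : v ∉ Set.range e) : x v = Function.extend e q x v :=
    (extend_apply_of_notMem_range e q x hv).symm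
  rw [Matrix.mul_apply, sum_eq_sum_extend e x _ fun y hy => by
    rw [parallel_apply_of_not_agree e A hy, zero_mul]]
  simp only [parallel_apply_of_agree e A (agree _), e.injective.extend_apply]
  by_cases h : ∀ v, v ∉ Set.range e → x v = z v
  · have h' (q : I × V → Bool) (v) (hv : v ∉ Set.range e) : Function.extend e q x v = z v := by
      rw [← agree q v hv, h v hv]
    simp only [parallel_apply_of_agree e _ h, parallel_apply_of_agree e _ (h' _),
      e.injective.extend_apply, ← Finset.prod_mul_distrib, Matrix.mul_apply]
    rw [Finset.prod_univ_sum, Fintype.piFinset_univ, ← (Equiv.curry I V Bool).sum_comp]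
    rfl
  · have h' (q : I × V → Bool) : ¬ ∀ v, v ∉ Set.range e → Function.extend e q x v = z v :=
      fun hq => h fun v hv => by rw [agree q v hv, hq v hv]
    simp only [parallel_apply_of_not_agree e _ h, parallel_apply_of_not_agree e _ (h' _),
      mul_zero, Finset.sum_const_zero]

theorem parallel_singleQubitLayer (e : I × V ↪ V') (L : V → Matrix.unitaryGroup Bool ℂ) :
    parallel e (singleQubitLayer L) =
      singleQubitLayer (Function.extend e (fun p => L p.2) fun _ => 1) := by
  classical
  ext x y
  set F : V' → Matrix.unitaryGroup Bool ℂ := Function.extend e (fun p => L p.2) fun _ => 1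
    with hF
  have on_register : ∏ v ∈ Finset.univ.map e, (F v : Matrix Bool Bool ℂ) (x v) (y v) =
      ∏ i, ∏ v, (L v : Matrix Bool Bool ℂ) (x (e (i, v))) (y (e (i, v))) := by
    simp only [hF, Finset.prod_map, e.injective.extend_apply, Fintype.prod_prod_type]
  have off_register : ∏ v ∈ (Finset.univ.map e)ᶜ, (F v : Matrix Bool Bool ℂ) (x v) (y v) =
      if ∀ v, v ∉ Set.range e → x v = y v then 1 else 0 := by
    rw [Finset.prod_congr rfl (g := fun v => if x v = y v then (1 : ℂ) else 0) fun v hv => ?_,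
      Finset.prod_ite_zero, Finset.prod_const_one]
    · simp
    · rw [hF, extend_apply_of_notMem_range e _ _ (by simpa using hv)]
      simp [Matrix.one_apply]
  calc parallel e (singleQubitLayer L) x y
      = (∏ i, ∏ v, (L v : Matrix Bool Bool ℂ) (x (e (i, v))) (y (e (i, v)))) *
          if ∀ v, v ∉ Set.range e → x v = y v then 1 else 0 := by
        simp [parallel, singleQubitLayer]
    _ = singleQubitLayer F x y := by
        rw [← on_register, ← off_register, Finset.prod_mul_prod_compl]
        rfl

theorem parallel_mulVec_ket (e : I × V ↪ V') {A : Matrix (V → Bool) (V → Bool) ℂ}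
    {x y : V' → Bool}
    (hA : ∀ i, A *ᵥ ket (fun v => x (e (i, v))) = ket fun v => y (e (i, v)))
    (hxy : ∀ v, v ∉ Set.range e → x v = y v) : parallel e A *ᵥ ket x = ket y := by
  classical
  have hA' (i) (u : V → Bool) : A u (fun v => x (e (i, v))) =
      if u = fun v => y (e (i, v)) then 1 else 0 := by
    rw [← mulVec_ket A, hA, ket_apply]
  ext z
  rw [mulVec_ket, ket_apply, parallel, Matrix.of_apply]
  simp only [hA', Finset.prod_ite_zero, Finset.prod_const_one, ← ite_and]
  refine if_congr ⟨fun ⟨off, on⟩ => ?_, ?_⟩ rfl rfl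
  · exact eq_of_eqOn_range e (fun u => congrFun (on u.1 (Finset.mem_univ _)) u.2)
      fun v hv => by rw [off v hv, hxy v hv]
  · rintro rfl
    exact ⟨fun v hv => (hxy v hv).symm, fun _ _ => rfl⟩

omit [Fintype I] [Fintype V] [Fintype V'] [DecidableEq V'] in
theorem CZLayer.pairwise_disjoint_map_sectR_trans (e : I × V ↪ V') (M : CZLayer V) :
    Pairwise (Function.onFun Disjoint fun q : I × M.supports =>
      q.2.1.map ((Function.Embedding.sectR q.1 V).trans e)) := by
  rintro ⟨i, S, hS⟩ ⟨j, T, hT⟩ hne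
  refine Finset.disjoint_left.2 fun v hvS hvT => hne ?_
  obtain ⟨a, ha, rfl⟩ := Finset.mem_map.1 hvS
  obtain ⟨b, hb, hab⟩ := Finset.mem_map.1 hvT
  obtain ⟨rfl, rfl⟩ := Prod.mk.inj (e.injective hab)
  simp only [M.disjoint.elim_finset hS hT b ha hb]

/-- The layer made of copies of the layer `M` in each of the registers `e (i, ·)`. -/
def CZLayer.parallel (e : I × V ↪ V') (M : CZLayer V) : CZLayer V' :=
  CZLayer.ofFamily
    (fun q : I × M.supports => q.2.1.map ((Function.Embedding.sectR q.1 V).trans e))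
    (fun q => (M.nonempty _ q.2.2).map) (M.pairwise_disjoint_map_sectR_trans e)

theorem CZLayer.sign_parallel (e : I × V ↪ V') (M : CZLayer V) (x : V' → Bool) :
    (M.parallel e).sign x = ∏ i, M.sign fun v => x (e (i, v)) := by
  rw [CZLayer.parallel, CZLayer.sign_ofFamily, Fintype.prod_prod_type]
  refine Finset.prod_congr rfl fun i _ => ?_
  rw [CZLayer.sign, ← Finset.prod_coe_sort M.supports]
  simp only [Finset.forall_mem_map, Function.Embedding.trans_apply,
    Function.Embedding.sectR_apply]

theorem parallel_toMatrix (e : I × V ↪ V') (M : CZLayer V) :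
    parallel e M.toMatrix = (M.parallel e).toMatrix := by
  refine matrix_ext_ket fun x => ?_
  ext y
  rw [mulVec_ket, mulVec_ket, M.toMatrix_eq_diagonal, CZLayer.toMatrix_eq_diagonal]
  by_cases hoff : ∀ v, v ∉ Set.range e → y v = x v
  · rw [parallel_apply_of_agree e _ hoff]
    simp only [Matrix.diagonal_apply, Finset.prod_ite_zero, CZLayer.sign_parallel]
    refine if_congr ⟨fun h => ?_, ?_⟩ rfl rfl
    · exact eq_of_eqOn_range e (fun u => congrFun (h u.1 (Finset.mem_univ _)) u.2) hoff
    · rintro rfl _ _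
      rfl
  · rw [parallel_apply_of_not_agree e _ hoff, Matrix.diagonal_apply_ne]
    rintro rfl
    exact hoff fun _ _ => rfl

theorem Realizes.parallel {P : Finset V → Prop} {Q : Finset V' → Prop} (e : I × V ↪ V')
    (hPQ : ∀ i S, P S → Q (S.map ((Function.Embedding.sectR i V).trans e))) {d : ℕ}
    {A : Matrix (V → Bool) (V → Bool) ℂ} (h : Realizes P d A) :
    Realizes Q d (parallel e A) := by
  induction h with
  | single L =>
    rw [parallel_singleQubitLayer]
    exact .single _
  | cz M h =>
    rw [parallel_toMatrix]
    exact .cz _ (CZLayer.forall_mem_supports_ofFamily.2 fun q => hPQ _ _ (h _ q.2.2))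
  | mul _ _ h₁ h₂ =>
    rw [parallel_mul]
    exact h₁.mul h₂

end Parallel

section Placement

variable {V V' : Type}

/-- The unitary that acts as `A` on the register `e` and as the identity on the other qubits. -/
noncomputable def extendUnitary (e : V ↪ V') (A : Matrix (V → Bool) (V → Bool) ℂ) :
    Matrix (V' → Bool) (V' → Bool) ℂ :=
  parallel ((Equiv.punitProd.{0} V).toEmbedding.trans e) A

theorem extendUnitary_apply (e : V ↪ V') (A : Matrix (V → Bool) (V → Bool) ℂ)
    (z y : V' → Bool) : extendUnitary e A z y = open Classical in
      if ∀ v, v ∉ Set.range e → z v = y v then A (fun v => z (e v)) (fun v => y (e v)) else 0 := by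
  classical
  have hr : Set.range ((Equiv.punitProd.{0} V).toEmbedding.trans e) = Set.range e := by
    ext v
    simp
  simp only [extendUnitary, parallel, Matrix.of_apply, hr, Finset.univ_unique,
    Finset.prod_singleton]
  rfl

theorem conjTranspose_extendUnitary (e : V ↪ V') (A : Matrix (V → Bool) (V → Bool) ℂ) :
    (extendUnitary e A)ᴴ = extendUnitary e Aᴴ := by
  classical
  ext z y
  rw [Matrix.conjTranspose_apply, extendUnitary_apply, extendUnitary_apply, apply_ite star,
    star_zero]
  exact if_congr (forall₂_congr fun _ _ => eq_comm) rfl rfl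

variable [Fintype V] [DecidableEq V] [Fintype V'] [DecidableEq V']

theorem Realizes.extend {P : Finset V → Prop} {Q : Finset V' → Prop} (e : V ↪ V')
    (hPQ : ∀ S, P S → Q (S.map e)) {d : ℕ}
    {A : Matrix (V → Bool) (V → Bool) ℂ} (h : Realizes P d A) :
    Realizes Q d (extendUnitary e A) :=
  h.parallel _ fun _ S hS => hPQ S hS

/-- The isometry that puts the register `V` on the qubits `e` of `V'`, all the other qubits being
in the basis state given by `ρ`. -/
noncomputable def placement (e : V ↪ V') (ρ : V' → Bool) : Matrix (V' → Bool) (V → Bool) ℂ :=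
  Matrix.of fun z x => if z = Function.extend e x ρ then 1 else 0

theorem placement_mulVec_ket (e : V ↪ V') (ρ : V' → Bool) (x : V → Bool) :
    placement e ρ *ᵥ ket x = ket (Function.extend e x ρ) := by
  ext z
  rw [mulVec_ket, ket_apply]
  rfl

theorem placement_mulVec_apply (e : V ↪ V') (ρ : V' → Bool) (φ : (V → Bool) → ℂ)
    (z : V' → Bool) : (placement e ρ *ᵥ φ) z = open Classical in
      if ∀ v, v ∉ Set.range e → z v = ρ v then φ fun v => z (e v) else 0 := by
  classical
  simp only [Matrix.mulVec, dotProduct, placement, Matrix.of_apply, eq_extend_iff,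
    ← funext_iff (f := fun u => z (e u)), ite_mul, one_mul, zero_mul, ite_and]
  rw [Finset.sum_ite_eq, if_pos (Finset.mem_univ _)]

theorem withAncilla_eq_placement_mulVec (e : V ↪ V') (φ : (V → Bool) → ℂ) :
    withAncilla e φ = placement e (fun _ => false) *ᵥ φ :=
  funext fun z => (placement_mulVec_apply e _ φ z).symm

theorem extendUnitary_mul_placement (e : V ↪ V') (A : Matrix (V → Bool) (V → Bool) ℂ)
    (ρ : V' → Bool) : extendUnitary e A * placement e ρ = placement e ρ * A := by
  refine matrix_ext_ket fun x => ?_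
  ext z
  have off_register : (∀ v, v ∉ Set.range e → z v = Function.extend e x ρ v) ↔
      ∀ v, v ∉ Set.range e → z v = ρ v :=
    forall₂_congr fun v hv => by rw [extend_apply_of_notMem_range e x ρ hv]
  rw [← Matrix.mulVec_mulVec, ← Matrix.mulVec_mulVec, placement_mulVec_ket,
    placement_mulVec_apply, mulVec_ket, mulVec_ket, extendUnitary_apply]
  simp only [off_register, e.injective.extend_apply]

end Placement

/-! ### Single-qubit gates and phases -/

section Gates

theorem inv_sqrt_two_mul_self : ((√2 : ℝ) : ℂ)⁻¹ * ((√2 : ℝ) : ℂ)⁻¹ = 1 / 2 := by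
  rw [← mul_inv, ← Complex.ofReal_mul, Real.mul_self_sqrt (by norm_num)]
  norm_num

/-- The gate `X`. -/
noncomputable def gateX : Matrix.unitaryGroup Bool ℂ :=
  ⟨Matrix.of fun a b => if a = !b then 1 else 0, by
    rw [Matrix.mem_unitaryGroup_iff]
    ext a b
    cases a <;> cases b <;> simp [Matrix.mul_apply, Matrix.star_apply]⟩

/-- The gate `Z`. -/
noncomputable def gateZ : Matrix.unitaryGroup Bool ℂ :=
  ⟨Matrix.diagonal fun a => if a then -1 else 1, by
    rw [Matrix.mem_unitaryGroup_iff]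
    ext a b
    cases a <;> cases b <;> simp [Matrix.mul_apply, Matrix.star_apply]⟩

/-- The Hadamard gate. -/
noncomputable def gateH : Matrix.unitaryGroup Bool ℂ :=
  ⟨Matrix.of fun a b => (if a && b then -1 else 1) * ((√2)⁻¹ : ℂ), by
    rw [Matrix.mem_unitaryGroup_iff]
    ext a b
    cases a <;> cases b <;>
      (simp [Matrix.mul_apply, Matrix.star_apply, inv_sqrt_two_mul_self]; try norm_num)⟩

theorem gateX_apply (a b : Bool) :
    (gateX : Matrix Bool Bool ℂ) a b = if a = !b then 1 else 0 := rfl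

theorem gateZ_apply (a b : Bool) :
    (gateZ : Matrix Bool Bool ℂ) a b = if a = b then (if a then -1 else 1) else 0 := rfl

theorem gateH_apply (a b : Bool) :
    (gateH : Matrix Bool Bool ℂ) a b = (if a && b then -1 else 1) * ((√2)⁻¹ : ℂ) := rfl

theorem gateX_mul_self : gateX * gateX = 1 := by
  ext a b
  cases a <;> cases b <;> simp [Matrix.mul_apply, gateX_apply]

theorem gateH_mul_self : gateH * gateH = 1 := by
  ext a b
  cases a <;> cases b <;>
    (simp [Matrix.mul_apply, gateH_apply, inv_sqrt_two_mul_self]; try norm_num)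

theorem gateH_mul_gateZ_mul_gateH : gateH * (gateZ * gateH) = gateX := by
  ext a b
  cases a <;> cases b <;>
    simp [Matrix.mul_apply, gateH_apply, gateZ_apply, gateX_apply, inv_sqrt_two_mul_self] <;>
    norm_num

variable {V : Type} [Fintype V] [DecidableEq V]

theorem mulVec_congr_of_support {m : Type} {A B : Matrix m (V → Bool) ℂ} {φ : (V → Bool) → ℂ}
    (h : ∀ y, φ y ≠ 0 → A *ᵥ ket y = B *ᵥ ket y) : A *ᵥ φ = B *ᵥ φ := by
  ext z
  refine Finset.sum_congr rfl fun y _ => ?_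
  by_cases hy : φ y = 0
  · rw [hy, mul_zero, mul_zero]
  · exact congrArg (· * φ y) (by simpa only [mulVec_ket] using congrFun (h y hy) z)

theorem singleQubitLayer_mulVec_ket_eq_ket {L : V → Matrix.unitaryGroup Bool ℂ}
    {x y : V → Bool}
    (h : ∀ v b, (L v : Matrix Bool Bool ℂ) b (x v) = if b = y v then 1 else 0) :
    singleQubitLayer L *ᵥ ket x = ket y := by
  ext z
  rw [singleQubitLayer_mulVec_ket, ket_apply]
  simp only [h, Finset.prod_ite_zero, Finset.prod_const_one]
  exact if_congr (by simp [funext_iff]) rfl rfl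

theorem flipLayer_mulVec_ket (f x : V → Bool) :
    (singleQubitLayer fun v => if f v then gateX else 1) *ᵥ ket x =
      ket fun v => xor (x v) (f v) := by
  refine singleQubitLayer_mulVec_ket_eq_ket fun v b => ?_
  cases hf : f v <;> cases hx : x v <;> cases b <;> simp [gateX_apply]

theorem signLayer_mulVec_ket (f x : V → Bool) :
    (singleQubitLayer fun v => if f v then gateZ else 1) *ᵥ ket x =
      (∏ v, if (f v && x v) = true then (-1 : ℂ) else 1) • ket x := by
  ext z
  rw [singleQubitLayer_mulVec_ket, Pi.smul_apply, smul_eq_mul]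
  by_cases h : z = x
  · subst h
    rw [ket_apply_self, mul_one]
    refine Finset.prod_congr rfl fun v _ => ?_
    cases hf : f v <;> cases hx : z v <;> simp [gateZ_apply]
  · rw [ket_apply_of_ne h, mul_zero]
    obtain ⟨v, hv⟩ := Function.ne_iff.1 h
    refine Finset.prod_eq_zero (Finset.mem_univ v) ?_
    split_ifs <;> simp [gateZ_apply, hv]

theorem conj_singleQubitLayer_mulVec_ket {K : Matrix (V → Bool) (V → Bool) ℂ}
    {L L' Z : V → Matrix.unitaryGroup Bool ℂ} {x : V → Bool}
    (hK : ∀ z, (∀ v, (L v : Matrix Bool Bool ℂ) (z v) (x v) ≠ 0) →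
      K *ᵥ ket z = singleQubitLayer Z *ᵥ ket z) :
    (singleQubitLayer L' * (K * singleQubitLayer L)) *ᵥ ket x =
      (singleQubitLayer fun v => L' v * (Z v * L v)) *ᵥ ket x := by
  have h : K *ᵥ (singleQubitLayer L *ᵥ ket x) =
      singleQubitLayer Z *ᵥ (singleQubitLayer L *ᵥ ket x) := by
    refine mulVec_congr_of_support fun z hz => hK z fun v => ?_
    rw [singleQubitLayer_mulVec_ket] at hz
    exact Finset.prod_ne_zero_iff.1 hz v (Finset.mem_univ v)
  simp only [singleQubitLayer_mul, ← Matrix.mulVec_mulVec, h]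

theorem realizes_diagonal_sign_beq {P : Finset V → Prop} (M : CZLayer V)
    (hM : ∀ S ∈ M.supports, P S) (pattern : V → Bool) :
    Realizes P 1 (Matrix.diagonal fun x => M.sign fun v => x v == pattern v) := by
  set X : Matrix (V → Bool) (V → Bool) ℂ :=
    singleQubitLayer fun v => if !pattern v then gateX else 1 with hX
  have h : Matrix.diagonal (fun x => M.sign fun v => x v == pattern v) =
      X * (M.toMatrix * X) := by
    refine matrix_ext_ket fun x => ?_
    have hx : (fun v => xor (x v) (!pattern v)) = fun v => x v == pattern v := by
      ext v
      cases x v <;> cases pattern v <;> rfl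
    have hx' : (fun v => xor (x v == pattern v) (!pattern v)) = x := by
      ext v
      cases x v <;> cases pattern v <;> rfl
    rw [diagonal_mulVec_ket, ← Matrix.mulVec_mulVec, ← Matrix.mulVec_mulVec, hX,
      flipLayer_mulVec_ket, hx, M.toMatrix_eq_diagonal, diagonal_mulVec_ket, Matrix.mulVec_smul,
      flipLayer_mulVec_ket, hx']
  rw [h]
  exact (Realizes.single _).mul ((Realizes.cz M hM).mul (Realizes.single _))

theorem realizes_diagonal_phase {P : Finset V → Prop} {S : Finset V} (hS : S.Nonempty) (hP : P S)
    (pattern : V → Bool) :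
    Realizes P 1
      (Matrix.diagonal fun x => if ∀ v ∈ S, x v = pattern v then (-1 : ℂ) else 1) := by
  have h := realizes_diagonal_sign_beq (P := P) (⟨{S}, by simpa, by simp⟩ : CZLayer V)
    (by simpa) pattern
  simpa only [CZLayer.sign, Finset.prod_singleton, beq_iff_eq] using h

end Gates

/-! ### Copying bits along disjoint wires -/

/-- The basis state `x` with the bits `b i` added at the places `f i`. -/
noncomputable def addBits {V I : Type} (x : V → Bool) (f : I → V) (b : I → Bool) : V → Bool :=
  fun v => xor (x v) (Function.extend f b (fun _ => false) v)

theorem addBits_apply {V I : Type} (x : V → Bool) {f : I → V} (hf : Function.Injective f)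
    (b : I → Bool) (i : I) : addBits x f b (f i) = xor (x (f i)) (b i) := by
  rw [addBits, hf.extend_apply]

theorem addBits_of_ne {V I : Type} (x : V → Bool) {f : I → V} (b : I → Bool) {v : V}
    (hv : ∀ i, v ≠ f i) : addBits x f b v = x v := by
  rw [addBits, Function.extend_apply' _ _ _ fun ⟨i, hi⟩ => hv i hi.symm, Bool.xor_false]

theorem addBits_update {V I : Type} [DecidableEq V] (x : V → Bool) {f : I → V} (b : I → Bool)
    {t : V} (ht : ∀ i, t ≠ f i) (c : Bool) :
    addBits (Function.update x t c) f b = Function.update (addBits x f b) t c := by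
  ext v
  by_cases h : v = t
  · subst h
    rw [addBits_of_ne _ _ ht, Function.update_self, Function.update_self]
  · rw [Function.update_of_ne h, addBits, addBits, Function.update_of_ne h]

/-- A family of wires: disjoint sets of qubits, each with a source and a target on it. -/
structure Wiring (V I : Type) where
  segment : I → Finset V
  source : I → V
  target : I → V
  source_mem : ∀ i, source i ∈ segment i
  target_mem : ∀ i, target i ∈ segment i
  source_ne_target : ∀ i, source i ≠ target i
  disjoint : Pairwise (Function.onFun Disjoint segment)

namespace Wiring

variable {V I : Type} (w : Wiring V I)

theorem segment_nonempty (i : I) : (w.segment i).Nonempty := ⟨_, w.source_mem i⟩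

theorem eq_of_mem_segment {i j : I} {v : V} (hi : v ∈ w.segment i) (hj : v ∈ w.segment j) :
    i = j :=
  by_contra fun hne => Finset.disjoint_left.1 (w.disjoint hne) hi hj

theorem source_injective : Function.Injective w.source := fun i j h =>
  w.eq_of_mem_segment (w.source_mem i) (h ▸ w.source_mem j)

theorem target_injective : Function.Injective w.target := fun i j h =>
  w.eq_of_mem_segment (w.target_mem i) (h ▸ w.target_mem j)

theorem source_ne_target_apply (i j : I) : w.source i ≠ w.target j := fun h => by
  obtain rfl := w.eq_of_mem_segment (w.source_mem i) (h ▸ w.target_mem j)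
  exact w.source_ne_target i h

open Classical in
/-- The single-qubit gates around the `CZ` gates of `Wiring.copy`: `X` on the interior of a wire,
so that a clean interior activates the gate, and `H` on its target, where it turns the
controlled `Z` into a controlled `X`. -/
noncomputable def gates (v : V) : Matrix.unitaryGroup Bool ℂ :=
  if ∃ i, w.target i = v then gateH
  else if ∃ i, v ∈ w.segment i ∧ v ≠ w.source i then gateX else 1

theorem gates_source (i : I) : w.gates (w.source i) = 1 := by
  rw [gates, if_neg fun ⟨j, hj⟩ => w.source_ne_target_apply i j hj.symm, if_neg]
  rintro ⟨j, hj, hne⟩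
  obtain rfl := w.eq_of_mem_segment hj (w.source_mem i)
  exact hne rfl

theorem gates_interior {i : I} {v : V} (hv : v ∈ w.segment i) (hs : v ≠ w.source i)
    (ht : v ≠ w.target i) : w.gates v = gateX := by
  rw [gates, if_neg, if_pos ⟨i, hv, hs⟩]
  rintro ⟨j, rfl⟩
  obtain rfl := w.eq_of_mem_segment hv (w.target_mem j)
  exact ht rfl

theorem gates_mul_sign_mul_gates (v : V) (b : I → Bool) :
    w.gates v * ((if Function.extend w.target b (fun _ => false) v then gateZ else 1) *
      w.gates v) = if Function.extend w.target b (fun _ => false) v then gateX else 1 := by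
  by_cases hv : ∃ i, w.target i = v
  · rw [gates, if_pos hv]
    split_ifs
    · exact gateH_mul_gateZ_mul_gateH
    · rw [one_mul, gateH_mul_self]
  · rw [Function.extend_apply' _ _ _ hv, if_neg Bool.false_ne_true, if_neg Bool.false_ne_true,
      one_mul, gates, if_neg hv]
    split_ifs
    · exact gateX_mul_self
    · exact one_mul 1

variable [Fintype V] [DecidableEq V] [Fintype I]

/-- The layer with one `CZ` gate on every wire. -/
def czLayer : CZLayer V := CZLayer.ofFamily w.segment w.segment_nonempty w.disjoint

/-- Controlled-`X` gates from the sources to the targets of the wires, provided that the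
interiors of the wires are in the state `|0⟩`. -/
noncomputable def copy : Matrix (V → Bool) (V → Bool) ℂ :=
  singleQubitLayer w.gates * (w.czLayer.toMatrix * singleQubitLayer w.gates)

theorem realizes_copy {P : Finset V → Prop} (hP : ∀ i, P (w.segment i)) :
    Realizes P 1 w.copy :=
  (Realizes.single _).mul <|
    (Realizes.cz _ (CZLayer.forall_mem_supports_ofFamily.2 hP)).mul (Realizes.single _)

theorem czLayer_mulVec_ket {z : V → Bool}
    (hz : ∀ i, ∀ v ∈ w.segment i, v ≠ w.source i → v ≠ w.target i → z v = true) :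
    w.czLayer.toMatrix *ᵥ ket z = (singleQubitLayer fun v =>
      if Function.extend w.target (fun i => z (w.source i)) (fun _ => false) v
        then gateZ else 1) *ᵥ ket z := by
  rw [CZLayer.toMatrix_eq_diagonal, diagonal_mulVec_ket, signLayer_mulVec_ket, czLayer,
    CZLayer.sign_ofFamily]
  congr 1
  refine Fintype.prod_of_injective w.target w.target_injective _ _ (fun v hv => ?_) fun i => ?_
  · rw [Function.extend_apply' _ _ _ hv]
    rfl
  · rw [w.target_injective.extend_apply]
    refine if_congr ⟨fun h => ?_, fun h v hv => ?_⟩ rfl rfl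
    · rw [h _ (w.source_mem i), h _ (w.target_mem i)]
      rfl
    · obtain ⟨hs, ht⟩ := (Bool.and_eq_true _ _).mp h
      rcases eq_or_ne v (w.source i) with rfl | hvs
      · exact hs
      rcases eq_or_ne v (w.target i) with rfl | hvt
      · exact ht
      exact hz i v hv hvs hvt

theorem copy_mulVec_ket {x : V → Bool}
    (hx : ∀ i, ∀ v ∈ w.segment i, v ≠ w.source i → v ≠ w.target i → x v = false) :
    w.copy *ᵥ ket x = ket (addBits x w.target fun i => x (w.source i)) := by
  rw [copy, conj_singleQubitLayer_mulVec_ket (Z := fun v => if Function.extend w.target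
    (fun i => x (w.source i)) (fun _ => false) v then gateZ else 1)]
  · simp only [gates_mul_sign_mul_gates]
    exact flipLayer_mulVec_ket _ x
  · intro z hz
    have source_eq (i) : z (w.source i) = x (w.source i) := by
      by_contra hne
      exact hz (w.source i) (by simp [gates_source, hne])
    rw [w.czLayer_mulVec_ket fun i v hv hs ht => ?_]
    · simp only [source_eq]
    · by_contra hne
      exact hz v (by simp [w.gates_interior hv hs ht, gateX_apply, hx i v hv hs ht, hne])

theorem copy_mulVec_ket_addBits {x : V → Bool} (hx : ∀ i, ∀ v ∈ w.segment i, x v = false)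
    (b : I → Bool) : w.copy *ᵥ ket (addBits x w.source b) =
      ket (addBits (addBits x w.source b) w.target b) := by
  rw [w.copy_mulVec_ket fun i v hv hs _ => ?_]
  · simp only [addBits_apply x w.source_injective, hx _ _ (w.source_mem _), Bool.false_xor]
  · rw [addBits_of_ne, hx i v hv]
    rintro j rfl
    obtain rfl := w.eq_of_mem_segment hv (w.source_mem j)
    exact hs rfl

end Wiring

/-! ### Exact amplitude amplification -/

section Grover

variable {V : Type} [Fintype V] [DecidableEq V] {P : Finset V → Prop}

theorem Realizes.pow {d : ℕ} {A : Matrix (V → Bool) (V → Bool) ℂ} (h : Realizes P d A) (j : ℕ) :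
    Realizes P (j * d) (A ^ j) := by
  induction j with
  | zero => simpa only [zero_mul, pow_zero] using Realizes.one
  | succ j ih => rw [pow_succ, Nat.succ_mul]; exact ih.mul h

theorem star_dotProduct_ket (φ : (V → Bool) → ℂ) (x : V → Bool) :
    star φ ⬝ᵥ ket x = star (φ x) := by
  simp [ket]

theorem conjTranspose_mulVec_apply (A : Matrix (V → Bool) (V → Bool) ℂ) (φ : (V → Bool) → ℂ)
    (x : V → Bool) : (Aᴴ *ᵥ φ) x = star (A *ᵥ ket x) ⬝ᵥ φ := by
  rw [← star_star ((Aᴴ *ᵥ φ) x), ← star_dotProduct_ket, Matrix.star_dotProduct, star_star,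
    Matrix.star_mulVec, ← Matrix.dotProduct_mulVec]

/-- The reflection that changes the sign of the amplitude of `|g⟩`. -/
noncomputable def phaseFlip (g : V → Bool) : Matrix (V → Bool) (V → Bool) ℂ :=
  Matrix.diagonal fun x => if x = g then -1 else 1

theorem realizes_phaseFlip [Nonempty V] (hP : P Finset.univ) (g : V → Bool) :
    Realizes P 1 (phaseFlip g) := by
  have h := realizes_diagonal_phase Finset.univ_nonempty hP g
  simp only [Finset.mem_univ, true_imp_iff] at h
  simpa only [phaseFlip, funext_iff] using h

theorem phaseFlip_mulVec (g : V → Bool) (φ : (V → Bool) → ℂ) :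
    phaseFlip g *ᵥ φ = φ - (2 * φ g) • ket g := by
  ext x
  rw [phaseFlip, Matrix.mulVec_diagonal, Pi.sub_apply, Pi.smul_apply, ket_apply, smul_eq_mul]
  split_ifs with h
  · rw [h]
    ring
  · ring

theorem conj_phaseFlip_mulVec {A : Matrix (V → Bool) (V → Bool) ℂ}
    (hA : A ∈ Matrix.unitaryGroup (V → Bool) ℂ) (o : V → Bool) (φ : (V → Bool) → ℂ) :
    (A * (phaseFlip o * Aᴴ)) *ᵥ φ = φ - (2 * (star (A *ᵥ ket o) ⬝ᵥ φ)) • (A *ᵥ ket o) := by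
  rw [← Matrix.mulVec_mulVec, ← Matrix.mulVec_mulVec, phaseFlip_mulVec, Matrix.mulVec_sub,
    mulVec_conjTranspose_mulVec_of_unitary hA, Matrix.mulVec_smul, conjTranspose_mulVec_apply]

/-- One round of Grover's algorithm for the initial state `A |o⟩` and the marked states
`g₀` and `g₁`. -/
noncomputable def groverStep (A : Matrix (V → Bool) (V → Bool) ℂ) (o g₀ g₁ : V → Bool) :
    Matrix (V → Bool) (V → Bool) ℂ :=
  A * (phaseFlip o * Aᴴ) * (phaseFlip g₀ * phaseFlip g₁)

theorem realizes_groverStep [Nonempty V] (hP : P Finset.univ) {d : ℕ}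
    {A : Matrix (V → Bool) (V → Bool) ℂ} (hA : Realizes P d A) (o g₀ g₁ : V → Bool) :
    Realizes P (2 * d + 3) (groverStep A o g₀ g₁) := by
  have h := (hA.mul ((realizes_phaseFlip hP o).mul hA.conjTranspose)).mul
    ((realizes_phaseFlip hP g₀).mul (realizes_phaseFlip hP g₁))
  exact h.mono (by omega)

variable {A : Matrix (V → Bool) (V → Bool) ℂ} {o g₀ g₁ : V → Bool} {t θ : ℝ}

theorem groverStep_mulVec (hA : A ∈ Matrix.unitaryGroup (V → Bool) ℂ) (hg : g₀ ≠ g₁)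
    (h₀ : A g₀ o = t) (h₁ : A g₁ o = t) (a b : ℂ) :
    groverStep A o g₀ g₁ *ᵥ (a • (ket g₀ + ket g₁) + b • (A *ᵥ ket o)) =
      -((a + 2 * b * t) • (ket g₀ + ket g₁) +
        (b - 4 * t * (a + 2 * b * t)) • (A *ᵥ ket o)) := by
  have amplitude₀ : (A *ᵥ ket o) g₀ = t := (mulVec_ket A o g₀).trans h₀
  have amplitude₁ : (A *ᵥ ket o) g₁ = t := (mulVec_ket A o g₁).trans h₁
  set κ : (V → Bool) → ℂ := ket g₀ + ket g₁ with hκ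
  set ψ := A *ᵥ ket o with hψ
  have ket_g₁ : ket g₁ g₀ = 0 := ket_apply_of_ne hg
  have κ_apply : κ g₀ = 1 ∧ κ g₁ = 1 := by simp [hκ, ket_apply, hg, hg.symm]
  have flip : (phaseFlip g₀ * phaseFlip g₁) *ᵥ (a • κ + b • ψ) =
      -(a + 2 * b * t) • κ + b • ψ := by
    rw [← Matrix.mulVec_mulVec, phaseFlip_mulVec, phaseFlip_mulVec]
    simp only [Pi.sub_apply, Pi.add_apply, Pi.smul_apply, smul_eq_mul, κ_apply, amplitude₀,
      amplitude₁, ket_g₁]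
    rw [hκ]
    module
  have overlap_κ : star ψ ⬝ᵥ κ = 2 * t := by
    rw [dotProduct_add, star_dotProduct_ket, star_dotProduct_ket, amplitude₀, amplitude₁,
      Complex.star_def, Complex.conj_ofReal, two_mul]
  have overlap_ψ : star ψ ⬝ᵥ ψ = 1 := by
    rw [hψ, star_mulVec_dotProduct_mulVec_of_unitary hA, star_dotProduct_ket, ket_apply_self,
      star_one]
  rw [groverStep, ← Matrix.mulVec_mulVec, flip, conj_phaseFlip_mulVec hA, ← hψ, dotProduct_add,
    dotProduct_smul, dotProduct_smul, overlap_κ, overlap_ψ]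
  simp only [smul_eq_mul]
  module

theorem cos_smul_groverStep_pow_mulVec (hA : A ∈ Matrix.unitaryGroup (V → Bool) ℂ)
    (hg : g₀ ≠ g₁) (h₀ : A g₀ o = t) (h₁ : A g₁ o = t) (ht : √2 * t = Real.sin θ) (k : ℕ) :
    (Real.cos θ : ℂ) • ((groverStep A o g₀ g₁ ^ k * A) *ᵥ ket o) = (-1 : ℂ) ^ k •
      (((Real.sin (2 * k * θ) / √2 : ℝ) : ℂ) • (ket g₀ + ket g₁) +
        (Real.cos ((2 * k + 1) * θ) : ℂ) • (A *ᵥ ket o)) := by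
  induction k with
  | zero => simp
  | succ k ih =>
    have ht' : t = Real.sin θ / √2 := by rw [← ht]; field_simp
    have sin_step : Real.sin (2 * (k + 1 : ℕ) * θ) / √2 =
        Real.sin (2 * k * θ) / √2 + 2 * Real.cos ((2 * k + 1) * θ) * t := by
      have h := Real.two_mul_sin_mul_cos θ ((2 * k + 1) * θ)
      rw [show θ - (2 * k + 1) * θ = -(2 * k * θ) by ring, Real.sin_neg,
        show θ + (2 * k + 1) * θ = 2 * (k + 1 : ℕ) * θ by push_cast; ring] at h
      rw [ht']
      linear_combination (-1 / √2) * h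
    have cos_step : Real.cos ((2 * (k + 1 : ℕ) + 1) * θ) =
        Real.cos ((2 * k + 1) * θ) - 4 * t * (Real.sin (2 * (k + 1 : ℕ) * θ) / √2) := by
      have h := Real.two_mul_sin_mul_sin θ (2 * (k + 1 : ℕ) * θ)
      rw [← Real.cos_neg, show -(θ - 2 * (k + 1 : ℕ) * θ) = (2 * k + 1) * θ by push_cast; ring,
        show θ + 2 * (k + 1 : ℕ) * θ = (2 * (k + 1 : ℕ) + 1) * θ by ring] at h
      have hsq : (√2)⁻¹ * (√2)⁻¹ = (1 / 2 : ℝ) := by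
        rw [← mul_inv, Real.mul_self_sqrt zero_le_two, one_div]
      rw [ht']
      linear_combination h + 4 * Real.sin θ * Real.sin (2 * (k + 1 : ℕ) * θ) * hsq
    rw [pow_succ', Matrix.mul_assoc, ← Matrix.mulVec_mulVec, ← Matrix.mulVec_smul, ih,
      Matrix.mulVec_smul, groverStep_mulVec hA hg h₀ h₁, smul_neg, ← neg_smul,
      pow_succ (-1 : ℂ) k, mul_neg_one, cos_step, sin_step]
    push_cast
    rfl

theorem exists_groverStep_pow_mulVec (hA : A ∈ Matrix.unitaryGroup (V → Bool) ℂ) (hg : g₀ ≠ g₁)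
    (h₀ : A g₀ o = t) (h₁ : A g₁ o = t) {j : ℕ} (hj : 1 ≤ j)
    (ht : √2 * t = Real.sin (Real.pi / (2 * (2 * j + 1)))) :
    ∃ α : ℂ, (groverStep A o g₀ g₁ ^ j * A) *ᵥ ket o = α • (ket g₀ + ket g₁) := by
  set θ : ℝ := Real.pi / (2 * (2 * j + 1)) with hθ
  have hj' : (1 : ℝ) ≤ j := by exact_mod_cast hj
  have cos_ne_zero : (Real.cos θ : ℂ) ≠ 0 := by
    have hlt : θ < Real.pi / 2 := div_lt_div_of_pos_left Real.pi_pos two_pos (by linarith)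
    have hpos : 0 < θ := by positivity
    exact_mod_cast (Real.cos_pos_of_mem_Ioo ⟨by linarith, hlt⟩).ne'
  have h := cos_smul_groverStep_pow_mulVec hA hg h₀ h₁ ht j
  rw [show (2 * j + 1) * θ = Real.pi / 2 by rw [hθ]; field_simp, Real.cos_pi_div_two,
    Complex.ofReal_zero, zero_smul, add_zero, smul_smul] at h
  exact ⟨_, by rw [← inv_smul_smul₀ cos_ne_zero ((groverStep A o g₀ g₁ ^ j * A) *ᵥ ket o), h,
    smul_smul]⟩

end Grover

theorem sin_grover_angle_nonneg (j : ℕ) : 0 ≤ Real.sin (Real.pi / (2 * (2 * j + 1))) :=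
  Real.sin_nonneg_of_nonneg_of_le_pi (by positivity)
    (div_le_self Real.pi_pos.le (by linarith [(Nat.cast_nonneg j : (0 : ℝ) ≤ j)]))

theorem exists_sin_grover_angle_le {δ : ℝ} (hδ : 0 < δ) :
    ∃ j : ℕ, 1 ≤ j ∧ Real.sin (Real.pi / (2 * (2 * j + 1))) ≤ δ := by
  obtain ⟨k, hk⟩ := exists_nat_gt (Real.pi / δ)
  refine ⟨k + 1, by omega, (Real.sin_le (by positivity)).trans ?_⟩
  rw [div_lt_iff₀ hδ] at hk
  rw [div_le_iff₀ (by positivity)]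
  push_cast
  nlinarith [(Nat.cast_nonneg k : (0 : ℝ) ≤ k)]

/-! ### Superpositions with equal weights -/

theorem exists_unitary_column (u v : ℂ) (h : ‖u‖ ^ 2 + ‖v‖ ^ 2 = 1) :
    ∃ U : Matrix.unitaryGroup Bool ℂ,
      (U : Matrix Bool Bool ℂ) false false = u ∧ (U : Matrix Bool Bool ℂ) true false = v := by
  have h' : u * star u + v * star v = 1 := by
    rw [Complex.star_def, Complex.mul_conj', Complex.mul_conj']
    exact_mod_cast h
  refine ⟨⟨Matrix.of fun a b =>
    if b then (if a then star u else -star v) else (if a then v else u), ?_⟩, rfl, rfl⟩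
  rw [Matrix.mem_unitaryGroup_iff]
  ext a b
  cases a <;> cases b <;>
    simp only [Matrix.mul_apply, Fintype.sum_bool, Matrix.star_apply, Matrix.of_apply,
      Matrix.one_apply, if_true, Bool.false_eq_true, if_false, reduceCtorEq, star_neg,
      star_star] <;>
    first | linear_combination h' | ring

/-- The first unitary makes the two amplitudes equal, the second one scales them down. -/
theorem exists_balancing_unitaries {a₀ a₁ : ℂ} {δ σ : ℝ} (hδ : 0 < δ) (h₀ : δ ≤ ‖a₀‖)
    (h₁ : δ ≤ ‖a₁‖) (hσ : 0 ≤ σ) (hσδ : σ ≤ δ) :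
    ∃ (U₀ U₁ : Matrix.unitaryGroup Bool ℂ) (t : ℝ), √2 * t = σ ∧
      a₀ * ((U₀ : Matrix Bool Bool ℂ) false false * (U₁ : Matrix Bool Bool ℂ) false false) = t ∧
      a₁ * ((U₀ : Matrix Bool Bool ℂ) true false * (U₁ : Matrix Bool Bool ℂ) false false) = t := by
  have pos₀ : 0 < ‖a₀‖ := hδ.trans_le h₀
  have pos₁ : 0 < ‖a₁‖ := hδ.trans_le h₁
  have ne₀ : a₀ ≠ 0 := norm_pos_iff.1 pos₀
  have ne₁ : a₁ ≠ 0 := norm_pos_iff.1 pos₁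
  set s : ℝ := 1 / ‖a₀‖ ^ 2 + 1 / ‖a₁‖ ^ 2 with hs
  have s_pos : 0 < s := by positivity
  have s_le : s ≤ 1 / δ ^ 2 + 1 / δ ^ 2 := by rw [hs]; gcongr
  have sqrt_ne : ((√s : ℝ) : ℂ) ≠ 0 := by exact_mod_cast (Real.sqrt_pos.2 s_pos).ne'
  set t : ℝ := σ / √2 with ht
  have scale_le : (t * √s) ^ 2 ≤ 1 := by
    rw [mul_pow, Real.sq_sqrt s_pos.le, ht, div_pow, Real.sq_sqrt zero_le_two]
    calc σ ^ 2 / 2 * s ≤ δ ^ 2 / 2 * (1 / δ ^ 2 + 1 / δ ^ 2) := by gcongr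
      _ = 1 := by field_simp; norm_num
  obtain ⟨U₀, hU₀, hU₀'⟩ := exists_unitary_column (((√s)⁻¹ : ℝ) / a₀) (((√s)⁻¹ : ℝ) / a₁) <| by
    rw [norm_div, norm_div, Complex.norm_real, div_pow, div_pow, Real.norm_eq_abs, sq_abs,
      inv_pow, Real.sq_sqrt s_pos.le, div_eq_mul_one_div, div_eq_mul_one_div s⁻¹, ← mul_add,
      ← hs, inv_mul_cancel₀ s_pos.ne']
  obtain ⟨U₁, hU₁, -⟩ := exists_unitary_column (t * √s : ℝ) (√(1 - (t * √s) ^ 2) : ℝ) <| by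
    rw [Complex.norm_real, Complex.norm_real, Real.norm_eq_abs, Real.norm_eq_abs, sq_abs, sq_abs,
      Real.sq_sqrt (by linarith)]
    ring
  refine ⟨U₀, U₁, t, by rw [ht]; field_simp, ?_, ?_⟩
  · rw [hU₀, hU₁]
    push_cast
    field_simp
  · rw [hU₀', hU₁]
    push_cast
    field_simp

section Superposition

variable {V W : Type} [Fintype V] [DecidableEq V] [Fintype W] [DecidableEq W]

theorem extendUnitary_inl_mul_singleQubitLayer_apply (A : Matrix (V → Bool) (V → Bool) ℂ)
    (U : W → Matrix.unitaryGroup Bool ℂ) (x x' : V → Bool) (y y' : W → Bool) :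
    (extendUnitary Function.Embedding.inl A * singleQubitLayer (Sum.elim (fun _ => 1) U) :
        Matrix (V ⊕ W → Bool) (V ⊕ W → Bool) ℂ) (Sum.elim x y) (Sum.elim x' y') =
      A x x' * ∏ w, (U w : Matrix Bool Bool ℂ) (y w) (y' w) := by
  classical
  set ι : V ↪ V ⊕ W := Function.Embedding.inl
  have extend_inr (q : V → Bool) (w : W) :
      Function.extend ι q (Sum.elim x y) (Sum.inr w) = y w :=
    extend_apply_of_notMem_range ι q _ (by simp [ι])
  have extend_inl (q : V → Bool) (v : V) :
      Function.extend ι q (Sum.elim x y) (Sum.inl v) = q v :=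
    ι.injective.extend_apply _ _ v
  have entry (q : V → Bool) :
      extendUnitary ι A (Sum.elim x y) (Function.extend ι q (Sum.elim x y)) = A x q := by
    rw [extendUnitary_apply, if_pos fun v hv => (extend_apply_of_notMem_range ι q _ hv).symm]
    exact congrArg (A x) (funext (extend_inl q))
  have layer_entry (q : V → Bool) : singleQubitLayer (Sum.elim (fun _ => 1) U)
        (Function.extend ι q (Sum.elim x y)) (Sum.elim x' y') =
      (1 : Matrix (V → Bool) (V → Bool) ℂ) q x' *
        ∏ w, (U w : Matrix Bool Bool ℂ) (y w) (y' w) := by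
    simp only [singleQubitLayer, ← singleQubitLayer_one, Matrix.of_apply, Fintype.prod_sum_type,
      extend_inl, extend_inr, Sum.elim_inl, Sum.elim_inr]
  rw [Matrix.mul_apply, sum_eq_sum_extend ι (Sum.elim x y) _ fun z hz => by
    rw [extendUnitary_apply, if_neg hz, zero_mul]]
  simp only [entry, layer_entry, ← mul_assoc]
  rw [← Finset.sum_mul, ← Matrix.mul_apply, mul_one]

/-- Two flag qubits balance the amplitudes of `g₀` and `g₁` before the amplification. -/
theorem Realizes.exists_superposition {d j : ℕ} (hj : 1 ≤ j)
    {A : Matrix (V → Bool) (V → Bool) ℂ} (hA : Realizes (fun _ => True) d A)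
    {o g₀ g₁ : V → Bool} {δ : ℝ} (hδ : 0 < δ)
    (hjδ : Real.sin (Real.pi / (2 * (2 * j + 1))) ≤ δ)
    (h₀ : δ ≤ ‖A g₀ o‖) (h₁ : δ ≤ ‖A g₁ o‖) :
    ∃ (B : Matrix (V ⊕ Bool → Bool) (V ⊕ Bool → Bool) ℂ) (α : ℂ),
      Realizes (fun _ => True) (j * (2 * d + 3) + d) B ∧
        B *ᵥ ket (Sum.elim o fun _ => false) = α •
          (ket (Sum.elim g₀ fun _ => false) + ket (Sum.elim g₁ fun c => !c)) := by
  obtain ⟨U₀, U₁, t, ht, ht₀, ht₁⟩ :=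
    exists_balancing_unitaries hδ h₀ h₁ (sin_grover_angle_nonneg j) hjδ
  have hB := (hA.extend (Q := fun _ => True) (Function.Embedding.inl : V ↪ V ⊕ Bool)
    (fun _ _ => trivial)).mul
      (Realizes.single (Sum.elim (fun _ : V => 1) fun c => if c then U₁ else U₀))
  have flags_ne : Sum.elim g₀ (fun _ => false) ≠ Sum.elim g₁ (fun c : Bool => !c) := fun h =>
    Bool.false_ne_true (congrFun h (Sum.inr false))
  obtain ⟨α, hα⟩ := exists_groverStep_pow_mulVec hB.mem_unitaryGroup (t := t)
    (o := Sum.elim o fun _ => false) flags_ne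
    (by
      rw [extendUnitary_inl_mul_singleQubitLayer_apply, Fintype.prod_bool, mul_comm]
      simpa [mul_comm] using ht₀)
    (by
      rw [extendUnitary_inl_mul_singleQubitLayer_apply, Fintype.prod_bool, mul_comm]
      simpa [mul_comm] using ht₁) hj ht
  exact ⟨_, α, ((realizes_groverStep trivial hB _ _ _).pow j).mul hB, hα⟩

end Superposition

/-! ### Cat states from approximate parity -/

section Approx

variable {V W : Type} [Fintype V] [DecidableEq V] [Fintype W] [DecidableEq W]

theorem isPureState_iff {ψ : (V → Bool) → ℂ} : IsPureState ψ ↔ star ψ ⬝ᵥ ψ = 1 := by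
  have h : star ψ ⬝ᵥ ψ = ((∑ x, ‖ψ x‖ ^ 2 : ℝ) : ℂ) := by
    push_cast
    exact Finset.sum_congr rfl fun x _ => Complex.conj_mul' (ψ x)
  rw [h, IsPureState, Complex.ofReal_eq_one]

theorem isPureState_mulVec_ket {A : Matrix (V → Bool) (V → Bool) ℂ}
    (hA : A ∈ Matrix.unitaryGroup (V → Bool) ℂ) (x : V → Bool) : IsPureState (A *ᵥ ket x) := by
  rw [isPureState_iff, star_mulVec_dotProduct_mulVec_of_unitary hA, star_dotProduct_ket,
    ket_apply_self, star_one]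

theorem withAncilla_mulVec_ket (ι : W ↪ V) (A : Matrix (W → Bool) (W → Bool) ℂ) (x : W → Bool) :
    withAncilla ι (A *ᵥ ket x) = extendUnitary ι A *ᵥ ket (Function.extend ι x fun _ => false) := by
  rw [withAncilla_eq_placement_mulVec, ← placement_mulVec_ket, Matrix.mulVec_mulVec,
    Matrix.mulVec_mulVec, extendUnitary_mul_placement]

/-- Undoing `L` after the circuit gives a state of fidelity at least `p` with
`r • (ket g₀ + ket g₁)`, which forces both amplitudes to be large. -/
theorem SolvesApproxClean.exists_amplitudes {p : ℝ} {C : QACCircuit V} {ι : W ↪ V}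
    {U : Matrix (W → Bool) (W → Bool) ℂ} (hC : SolvesApproxClean p C ι U) {k l : ℕ}
    {K L : Matrix (W → Bool) (W → Bool) ℂ} (hK : Realizes (fun _ => True) k K)
    (hL : Realizes (fun _ => True) l L) {o g₀ g₁ : W → Bool} {r : ℂ} (hr : ‖r‖ ^ 2 = 1 / 2)
    (hU : U *ᵥ (K *ᵥ ket o) = r • (L *ᵥ (ket g₀ + ket g₁))) :
    ∃ A, Realizes (fun _ => True) (l + (C.depth + k)) A ∧ ∀ g ∈ ({g₀, g₁} : Set (W → Bool)),
      √(2 * p) - 1 ≤ ‖A (Function.extend ι g fun _ => false)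
        (Function.extend ι o fun _ => false)‖ := by
  have hK' := hK.extend (Q := fun _ => True) ι fun _ _ => trivial
  have hL' := hL.extend (Q := fun _ => True) ι fun _ _ => trivial
  set A := (extendUnitary ι L)ᴴ * (C.toMatrix * extendUnitary ι K) with hA
  have hAr : Realizes (fun _ => True) (l + (C.depth + k)) A :=
    hL'.conjTranspose.mul (C.realizes.mul hK')
  set amplitude : (W → Bool) → ℂ := fun g =>
    A (Function.extend ι g fun _ => false) (Function.extend ι o fun _ => false)
  have amplitude_le_one (g : W → Bool) : ‖amplitude g‖ ≤ 1 :=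
    entry_norm_bound_of_unitary hAr.mem_unitaryGroup _ _
  have overlap (g : W → Bool) :
      star (C.toMatrix *ᵥ withAncilla ι (K *ᵥ ket o)) ⬝ᵥ withAncilla ι (L *ᵥ ket g) =
        star (amplitude g) := by
    change _ = star (A _ _)
    rw [withAncilla_mulVec_ket, withAncilla_mulVec_ket, ← mulVec_ket A, hA,
      ← Matrix.mulVec_mulVec, conjTranspose_mulVec_apply, Matrix.star_dotProduct,
      ← Matrix.mulVec_mulVec]
  have fidelity : p ≤ ‖r * (star (amplitude g₀) + star (amplitude g₁))‖ ^ 2 := by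
    have h := hC _ (isPureState_mulVec_ket hK.mem_unitaryGroup o)
    rwa [pureFidelity, hU, Matrix.mulVec_add, withAncilla_eq_placement_mulVec _ (r • _),
      Matrix.mulVec_smul, Matrix.mulVec_add, ← withAncilla_eq_placement_mulVec,
      ← withAncilla_eq_placement_mulVec, dotProduct_smul, dotProduct_add, overlap, overlap,
      smul_eq_mul] at h
  have sqrt_le : √(2 * p) ≤ ‖amplitude g₀‖ + ‖amplitude g₁‖ := by
    rw [norm_mul, mul_pow, hr, ← star_add, norm_star] at fidelity
    refine Real.sqrt_le_iff.2 ⟨by positivity, ?_⟩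
    calc 2 * p ≤ ‖amplitude g₀ + amplitude g₁‖ ^ 2 := by linarith
      _ ≤ (‖amplitude g₀‖ + ‖amplitude g₁‖) ^ 2 := by gcongr; exact norm_add_le _ _
  refine ⟨A, hAr, ?_⟩
  rintro g (rfl | rfl)
  · linarith [amplitude_le_one g₁]
  · linarith [amplitude_le_one g₀]

end Approx

/-- The parity of a family of bits. -/
def parityOf {J : Type} [Fintype J] (x : J → Bool) : Bool :=
  decide (Odd (Finset.univ.filter fun j => x j = true).card)

theorem prod_sign_eq_parityOf {J : Type} [Fintype J] (x : J → Bool) :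
    (∏ j, if x j = true then (-1 : ℂ) else 1) = if parityOf x then -1 else 1 := by
  rw [Finset.prod_ite, Finset.prod_const, Finset.prod_const_one, mul_one, parityOf]
  by_cases h : Odd (Finset.univ.filter fun j => x j = true).card
  · simp [h, h.neg_one_pow]
  · simp [h, (Nat.not_odd_iff_even.1 h).neg_one_pow]

theorem parityUnitary_mulVec_apply {n : ℕ} (φ : (Fin n ⊕ Unit → Bool) → ℂ)
    (y : Fin n ⊕ Unit → Bool) : (parityUnitary n *ᵥ φ) y = φ (Sum.elim (fun i => y (Sum.inl i))
      fun _ => xor (y (Sum.inr ())) (parityBit fun i => y (Sum.inl i))) := by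
  have solve (z : Fin n ⊕ Unit → Bool) :
      (y = Sum.elim (fun i => z (Sum.inl i))
        fun _ => xor (z (Sum.inr ())) (parityBit fun i => z (Sum.inl i))) ↔
      Sum.elim (fun i => y (Sum.inl i))
        (fun _ => xor (y (Sum.inr ())) (parityBit fun i => y (Sum.inl i))) = z := by
    constructor <;>
    · rintro rfl
      ext (i | _) <;> simp
  simp only [Matrix.mulVec, dotProduct, parityUnitary, Matrix.of_apply, solve, ite_mul, one_mul,
    zero_mul, Finset.sum_ite_eq, Finset.mem_univ, if_true]

/-- In the Hadamard basis, `U_⊕` maps `|+…+, 0⟩` to a cat state. -/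
theorem parityUnitary_mulVec_hadamard (n : ℕ) :
    parityUnitary n *ᵥ (singleQubitLayer (Sum.elim (fun _ => gateH) fun _ => 1) *ᵥ
        ket fun _ => false) =
      ((√2 : ℝ) : ℂ)⁻¹ • (singleQubitLayer (fun _ => gateH) *ᵥ
        (ket (fun _ => false) + ket fun _ => true)) := by
  ext y
  rw [parityUnitary_mulVec_apply, singleQubitLayer_mulVec_ket, Matrix.mulVec_add, Pi.smul_apply,
    Pi.add_apply, singleQubitLayer_mulVec_ket, singleQubitLayer_mulVec_ket]
  simp only [Fintype.prod_sum_type, Finset.univ_unique, Finset.prod_singleton,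
    PUnit.default_eq_unit, Sum.elim_inl, Sum.elim_inr]
  simp only [OneMemClass.coe_one, Matrix.one_apply, gateH_apply, Bool.and_false, Bool.and_true,
    Bool.false_eq_true, if_false, one_mul, Finset.prod_mul_distrib, prod_sign_eq_parityOf,
    Finset.prod_const, Finset.card_univ, Fintype.card_fin, smul_eq_mul]
  have parityOf_eq : parityOf (fun i => y (Sum.inl i)) = parityBit fun i => y (Sum.inl i) := rfl
  rw [parityOf_eq]
  cases y (Sum.inr ()) <;> cases parityBit fun i => y (Sum.inl i) <;> norm_num <;>
    linear_combination (-2 * (((√2 : ℝ) : ℂ)⁻¹) ^ n) * inv_sqrt_two_mul_self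

theorem SolvesApproxClean.exists_cat_amplitudes {V : Type} [Fintype V] [DecidableEq V] {n : ℕ}
    {p : ℝ} {C : QACCircuit V} {ι : Fin n ⊕ Unit ↪ V}
    (hC : SolvesApproxClean p C ι (parityUnitary n)) :
    ∃ A, Realizes (fun _ => True) C.depth A ∧ ∀ b : Bool,
      √(2 * p) - 1 ≤ ‖A (Function.extend ι (fun _ => b) fun _ => false) fun _ => false‖ := by
  have norm_sq : ‖((√2 : ℝ) : ℂ)⁻¹‖ ^ 2 = 1 / 2 := by
    rw [← norm_pow, sq, inv_sqrt_two_mul_self]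
    norm_num
  obtain ⟨A, hA, h⟩ := hC.exists_amplitudes (.single _) (.single _) norm_sq
    (parityUnitary_mulVec_hadamard n)
  rw [Function.extend_const] at h
  refine ⟨A, by simpa only [zero_add, add_zero] using hA, fun b => h _ ?_⟩
  cases b
  · exact Or.inl rfl
  · exact Or.inr rfl

/-! ### Exact parity -/

/-- `A` adds the parity of the qubits `inp j` to the qubit `tgt`, provided that all the other
qubits are in the state `|0⟩`. -/
def ComputesParity {V J : Type} [Fintype V] [DecidableEq V] [Fintype J]
    (A : Matrix (V → Bool) (V → Bool) ℂ) (inp : J → V) (tgt : V) : Prop :=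
  ∀ x : V → Bool, (∀ v, (∀ j, v ≠ inp j) → v ≠ tgt → x v = false) →
    A *ᵥ ket x = ket (Function.update x tgt (xor (x tgt) (parityOf fun j => x (inp j))))

theorem placement_inl_mulVec_apply {V W : Type} [Fintype V] [DecidableEq V] [Fintype W]
    (y : V → Bool) (w : W → Bool) (φ : (V → Bool) → ℂ) (x : V → Bool) (u : W → Bool) :
    (placement .inl (Sum.elim y w) *ᵥ φ) (Sum.elim x u) = if u = w then φ x else 0 := by
  classical
  rw [placement_mulVec_apply]
  refine if_congr ⟨fun h => funext fun v => h (Sum.inr v) (by simp), ?_⟩ rfl rfl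
  rintro rfl (v | v) hv
  · exact absurd ⟨v, rfl⟩ hv
  · rfl

theorem exists_eq_sumElim {V W β : Type} {x : V → β} {z : V ⊕ W → β}
    (hz : ∀ v, z (Sum.inl v) = x v) : ∃ w, z = Sum.elim x w :=
  ⟨z ∘ Sum.inr, by rw [← funext hz]; exact (Sum.elim_comp_inl_inr z).symm⟩

theorem kickback_disjoint {V W J : Type} [DecidableEq V] [DecidableEq W] (c : J ↪ V)
    (inp : J ↪ W) : Pairwise (Function.onFun Disjoint
      fun j => ({Sum.inl (c j), Sum.inr (inp j)} : Finset (V ⊕ W))) := fun i j hij => by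
  simp [Function.onFun, Ne.symm hij]

section Kickback

variable {V W J : Type} [Fintype V] [DecidableEq V] [Fintype W] [DecidableEq W] [Fintype J]

theorem extendUnitary_mulVec_placement_mulVec (e : V ↪ W) (A : Matrix (V → Bool) (V → Bool) ℂ)
    (ρ : W → Bool) (φ : (V → Bool) → ℂ) :
    extendUnitary e A *ᵥ (placement e ρ *ᵥ φ) = placement e ρ *ᵥ (A *ᵥ φ) := by
  rw [Matrix.mulVec_mulVec, extendUnitary_mul_placement, ← Matrix.mulVec_mulVec]

theorem placement_inl_mulVec_ket (x y : V → Bool) (w : W → Bool) :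
    placement .inl (Sum.elim y w) *ᵥ ket x = ket (Sum.elim x w) := by
  rw [placement_mulVec_ket]
  refine congrArg ket (Eq.symm ((eq_extend_iff _).2 ⟨fun _ => rfl, ?_⟩))
  rintro (v | v) hv
  · exact absurd ⟨v, rfl⟩ hv
  · rfl

/-- `CZ` gates on the pairs of a qubit `c j` of the register `V` and the qubit `inp j` of `W`. -/
def kickbackLayer (c : J ↪ V) (inp : J ↪ W) : CZLayer (V ⊕ W) :=
  .ofFamily (fun j => {Sum.inl (c j), Sum.inr (inp j)}) (fun _ => Finset.insert_nonempty _ _)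
    (kickback_disjoint c inp)

theorem kickbackLayer_sign (c : J ↪ V) (inp : J ↪ W) (x : V → Bool) (w : W → Bool) :
    (kickbackLayer c inp).sign (Sum.elim x w) =
      ∏ j, if x (c j) = true ∧ w (inp j) = true then (-1 : ℂ) else 1 := by
  rw [kickbackLayer, CZLayer.sign_ofFamily]
  simp only [Finset.forall_mem_insert, Finset.mem_singleton, forall_eq, Sum.elim_inl, Sum.elim_inr]

/-- Phase kickback: prepare a state of `V` with `A`, apply the `CZ` gates of `kickbackLayer`,
and undo `A`. -/
noncomputable def kickback (A : Matrix (V → Bool) (V → Bool) ℂ) (c : J ↪ V) (inp : J ↪ W) :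
    Matrix (V ⊕ W → Bool) (V ⊕ W → Bool) ℂ :=
  (extendUnitary .inl A)ᴴ * ((kickbackLayer c inp).toMatrix * extendUnitary .inl A)

variable {d : ℕ} {A : Matrix (V → Bool) (V → Bool) ℂ} {α : ℂ} {g : V → Bool} {c : J ↪ V}

theorem realizes_kickback (hA : Realizes (fun _ => True) d A) (c : J ↪ V) (inp : J ↪ W) :
    Realizes (fun _ => True) (2 * d + 1) (kickback A c inp) := by
  have hA' := hA.extend (Q := fun _ => True) (.inl : V ↪ V ⊕ W) fun _ _ => trivial
  exact (hA'.conjTranspose.mul ((Realizes.cz _ fun _ _ => trivial).mul hA')).mono (by omega)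

theorem kickback_mulVec_ket (hv : A *ᵥ ket (fun _ => false) = α • (ket (fun _ => false) + ket g))
    (hg : ∀ j, g (c j) = true) (inp : J ↪ W) (w : W → Bool) :
    kickback A c inp *ᵥ ket (Sum.elim (fun _ => false) w) =
      placement .inl (Sum.elim (fun _ => false) w) *ᵥ (Aᴴ *ᵥ (α • (ket (fun _ => false) +
        (if parityOf fun j => w (inp j) then (-1 : ℂ) else 1) • ket g))) := by
  set E : Matrix (V ⊕ W → Bool) (V → Bool) ℂ := placement .inl (Sum.elim (fun _ => false) w)
  have prepare : extendUnitary .inl A *ᵥ ket (Sum.elim (fun _ => false) w) =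
      α • (ket (Sum.elim (fun _ => false) w) + ket (Sum.elim g w)) := by
    rw [← placement_inl_mulVec_ket _ (fun _ => false), extendUnitary_mulVec_placement_mulVec, hv,
      Matrix.mulVec_smul, Matrix.mulVec_add, placement_inl_mulVec_ket, placement_inl_mulVec_ket]
  have sign_zero : (kickbackLayer c inp).sign (Sum.elim (fun _ => false) w) = 1 := by
    simp only [kickbackLayer_sign, Bool.false_eq_true, false_and, if_false, Finset.prod_const_one]
  have sign_g : (kickbackLayer c inp).sign (Sum.elim g w) =
      if parityOf fun j => w (inp j) then -1 else 1 := by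
    simp only [kickbackLayer_sign, hg, true_and, prod_sign_eq_parityOf]
  rw [kickback, ← Matrix.mulVec_mulVec, ← Matrix.mulVec_mulVec, prepare, Matrix.mulVec_smul,
    Matrix.mulVec_add, CZLayer.toMatrix_eq_diagonal, diagonal_mulVec_ket, diagonal_mulVec_ket,
    sign_zero, sign_g, one_smul, ← placement_inl_mulVec_ket _ (fun _ => false),
    ← placement_inl_mulVec_ket g (fun _ => false), ← Matrix.mulVec_smul, ← Matrix.mulVec_add,
    ← Matrix.mulVec_smul, conjTranspose_extendUnitary, extendUnitary_mulVec_placement_mulVec]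

theorem kickback_mulVec_ket_of_even (hA : A ∈ Matrix.unitaryGroup (V → Bool) ℂ)
    (hv : A *ᵥ ket (fun _ => false) = α • (ket (fun _ => false) + ket g))
    (hg : ∀ j, g (c j) = true) {inp : J ↪ W} {w : W → Bool}
    (hw : parityOf (fun j => w (inp j)) = false) :
    kickback A c inp *ᵥ ket (Sum.elim (fun _ => false) w) =
      ket (Sum.elim (fun _ => false) w) := by
  rw [kickback_mulVec_ket hv hg, hw, if_neg Bool.false_ne_true, one_smul, ← hv,
    conjTranspose_mulVec_mulVec_of_unitary hA, placement_inl_mulVec_ket]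

theorem kickback_mulVec_ket_of_odd
    (hv : A *ᵥ ket (fun _ => false) = α • (ket (fun _ => false) + ket g))
    (hg : ∀ j, g (c j) = true) {inp : J ↪ W} {w : W → Bool}
    (hw : parityOf (fun j => w (inp j)) = true) (u : W → Bool) :
    (kickback A c inp *ᵥ ket (Sum.elim (fun _ => false) w)) (Sum.elim (fun _ => false) u) = 0 := by
  have orthogonal : star (ket (fun _ => false) + ket g) ⬝ᵥ (ket (fun _ => false) - ket g) = 0 := by
    rw [dotProduct_sub, star_dotProduct_ket, star_dotProduct_ket, ← star_sub, Pi.add_apply,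
      Pi.add_apply, ket_apply_self, ket_apply_self, ket_apply, ket_apply]
    by_cases h : g = fun _ => false
    · simp [h]
    · simp [h, Ne.symm h]
  rw [kickback_mulVec_ket hv hg, hw, if_pos rfl, placement_inl_mulVec_apply,
    conjTranspose_mulVec_apply, hv, neg_one_smul, ← sub_eq_add_neg, dotProduct_smul, star_smul,
    smul_dotProduct, orthogonal, smul_zero, smul_zero, ite_self]

/-- The phase `-1` on the basis states with all bits of `V` equal to `0` and bit `t` equal
to `1`. -/
noncomputable def controlledZeroPhase (V : Type) [Fintype V] [DecidableEq V] (t : W) :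
    Matrix (V ⊕ W → Bool) (V ⊕ W → Bool) ℂ :=
  Matrix.diagonal fun x => if x (Sum.inr t) = true ∧ ∀ v, x (Sum.inl v) = false then -1 else 1

theorem realizes_controlledZeroPhase (t : W) :
    Realizes (fun _ => True) 1 (controlledZeroPhase V t) := by
  have h := realizes_diagonal_phase (P := fun _ => True)
    (Finset.insert_nonempty (Sum.inr t) (Finset.univ.map (.inl : V ↪ V ⊕ W))) trivial
    (Sum.elim (fun _ => false) fun _ => true)
  simpa only [controlledZeroPhase, Finset.forall_mem_insert, Finset.forall_mem_map,
    Finset.mem_univ, true_imp_iff, Function.Embedding.inl_apply, Sum.elim_inl, Sum.elim_inr] using h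

theorem controlledZeroPhase_mulVec_kickback (hA : A ∈ Matrix.unitaryGroup (V → Bool) ℂ)
    (hv : A *ᵥ ket (fun _ => false) = α • (ket (fun _ => false) + ket g))
    (hg : ∀ j, g (c j) = true) (inp : J ↪ W) (t : W) (w : W → Bool) :
    controlledZeroPhase V t *ᵥ (kickback A c inp *ᵥ ket (Sum.elim (fun _ => false) w)) =
      (if w t = true ∧ parityOf (fun j => w (inp j)) = false then (-1 : ℂ) else 1) •
        (kickback A c inp *ᵥ ket (Sum.elim (fun _ => false) w)) := by
  cases hw : parityOf fun j => w (inp j)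
  · rw [kickback_mulVec_ket_of_even hA hv hg hw, controlledZeroPhase, diagonal_mulVec_ket]
    simp only [Sum.elim_inl, Sum.elim_inr, implies_true, and_true]
  · ext x
    rw [controlledZeroPhase, Matrix.mulVec_diagonal, if_neg (c := _ ∧ true = false) (by simp),
      one_smul]
    split_ifs with hx
    · obtain ⟨u, rfl⟩ := exists_eq_sumElim hx.2
      rw [kickback_mulVec_ket_of_odd hv hg hw, mul_zero]
    · rw [one_mul]

/-- Changes the sign if `t` is `1` and the parity of the bits `inp j` is even. -/
noncomputable def parityPhase (A : Matrix (V → Bool) (V → Bool) ℂ) (c : J ↪ V) (inp : J ↪ W)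
    (t : W) : Matrix (V ⊕ W → Bool) (V ⊕ W → Bool) ℂ :=
  (kickback A c inp)ᴴ * (controlledZeroPhase V t * kickback A c inp)

theorem realizes_parityPhase (hA : Realizes (fun _ => True) d A) (c : J ↪ V) (inp : J ↪ W)
    (t : W) : Realizes (fun _ => True) (4 * d + 3) (parityPhase A c inp t) :=
  ((realizes_kickback hA c inp).conjTranspose.mul
    ((realizes_controlledZeroPhase t).mul (realizes_kickback hA c inp))).mono (by omega)

theorem parityPhase_mulVec_ket (hA : Realizes (fun _ => True) d A)
    (hv : A *ᵥ ket (fun _ => false) = α • (ket (fun _ => false) + ket g))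
    (hg : ∀ j, g (c j) = true) (inp : J ↪ W) (t : W) {z : V ⊕ W → Bool}
    (hz : ∀ v, z (Sum.inl v) = false) :
    parityPhase A c inp t *ᵥ ket z = (if z (Sum.inr t) = true ∧
      parityOf (fun j => z (Sum.inr (inp j))) = false then (-1 : ℂ) else 1) • ket z := by
  obtain ⟨w, rfl⟩ := exists_eq_sumElim hz
  rw [parityPhase, ← Matrix.mulVec_mulVec, ← Matrix.mulVec_mulVec,
    controlledZeroPhase_mulVec_kickback hA.mem_unitaryGroup hv hg, Matrix.mulVec_smul,
    conjTranspose_mulVec_mulVec_of_unitary (realizes_kickback hA c inp).mem_unitaryGroup]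
  rfl

theorem Realizes.exists_computesParity (hA : Realizes (fun _ => True) d A)
    (hv : A *ᵥ ket (fun _ => false) = α • (ket (fun _ => false) + ket g))
    (hg : ∀ j, g (c j) = true) (inp : J ↪ W) {t : W} (ht : ∀ j, inp j ≠ t) :
    ∃ B, Realizes (fun _ => True) (4 * d + 3) B ∧
      ComputesParity B (fun j => Sum.inr (inp j) : J → V ⊕ W) (Sum.inr t) := by
  refine ⟨singleQubitLayer (fun v => if v = Sum.inr t then gateX * gateH else 1) *
    (parityPhase A c inp t * singleQubitLayer fun v => if v = Sum.inr t then gateH else 1),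
    ((Realizes.single _).mul ((realizes_parityPhase hA c inp t).mul (.single _))).mono (by omega),
    fun x hx => ?_⟩
  set par := parityOf fun j => x (Sum.inr (inp j))
  rw [conj_singleQubitLayer_mulVec_ket
    (Z := fun v => if decide (v = Sum.inr t) && !par then gateZ else 1)]
  · have layer_eq (v : V ⊕ W) : (if v = Sum.inr t then gateX * gateH else 1) *
        ((if (decide (v = Sum.inr t) && !par) = true then gateZ else 1) *
          if v = Sum.inr t then gateH else 1) =
        if (decide (v = Sum.inr t) && par) = true then gateX else 1 := by
      by_cases h : v = Sum.inr t <;> cases par <;>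
        simp [h, mul_assoc, gateH_mul_gateZ_mul_gateH, gateX_mul_self, gateH_mul_self]
    simp only [layer_eq, flipLayer_mulVec_ket]
    refine congrArg ket (funext fun v => ?_)
    by_cases h : v = Sum.inr t
    · subst h
      simp
    · simp [h]
  · intro z hz
    have z_eq (v : V ⊕ W) (h : v ≠ Sum.inr t) : z v = x v := by
      by_contra hne
      exact hz v (by simp [h, hne])
    have par_eq : parityOf (fun j => z (Sum.inr (inp j))) = par :=
      congrArg parityOf (funext fun j => z_eq _ fun h => ht j (Sum.inr_injective h))
    rw [parityPhase_mulVec_ket hA hv hg inp t fun v =>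
      (z_eq _ (by simp)).trans (hx _ (by simp) (by simp)), par_eq, signLayer_mulVec_ket]
    congr 1
    rw [Finset.prod_eq_single (Sum.inr t) (fun v _ h => by simp [h]) (by simp)]
    exact if_congr (by simp [and_comm]) rfl rfl

end Kickback

/-- The register of the exact parity circuit: the qubits of the given circuit, two qubits used for
the amplification, and the input and target qubits. -/
abbrev ParityRegister (n a : ℕ) : Type := (((Fin n ⊕ Unit) ⊕ Fin a) ⊕ Bool) ⊕ (Fin n ⊕ Unit)

theorem QAC0Family.exists_computesParity {p : ℝ} (hp : 1 / 2 < p) (C : QAC0Family)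
    (hC : ∀ n, SolvesApproxClean p (C.circuit n) Function.Embedding.inl (parityUnitary n)) :
    ∃ d, ∀ n, ∃ B, Realizes (fun _ => True) d B ∧
      ComputesParity B (fun i => Sum.inr (Sum.inl i) : Fin n → ParityRegister n (C.ancillas n))
        (Sum.inr (Sum.inr ())) := by
  obtain ⟨d, hd⟩ := C.const_depth
  have amplitude_pos : 0 < √(2 * p) - 1 := by
    have h : 1 < √(2 * p) := Real.lt_sqrt_of_sq_lt (by linarith)
    linarith
  obtain ⟨j, hj, angle_le⟩ := exists_sin_grover_angle_le amplitude_pos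
  refine ⟨4 * (j * (2 * d + 3) + d) + 3, fun n => ?_⟩
  obtain ⟨A, hA, amplitude_le⟩ := (hC n).exists_cat_amplitudes
  obtain ⟨B, α, hB, cat⟩ := (hA.mono (hd n)).exists_superposition hj amplitude_pos angle_le
    (amplitude_le false) (amplitude_le true)
  rw [Function.extend_const, Sum.elim_lam_const_lam_const] at cat
  have all_ones (i : Fin n) : Function.extend (Function.Embedding.inl : Fin n ⊕ Unit ↪ _)
      (fun _ => true) (fun _ => false) (Sum.inl (Sum.inl i) : _ ⊕ Fin (C.ancillas n)) = true :=
    Function.Embedding.inl.injective.extend_apply _ _ (Sum.inl i)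
  exact hB.exists_computesParity (c := Function.Embedding.inl.trans (.trans .inl .inl)) cat
    all_ones .inl fun _ => Sum.inl_ne_inr

/-! ### Simulation on a lattice -/

section LineInterval

theorem isLineInterval_row {w l : ℕ} (i : Fin w) (a b : Fin l) :
    IsLineInterval ({i} ×ˢ Finset.Icc a b) :=
  Or.inl ⟨i, a, b, rfl⟩

theorem isLineInterval_column {w l : ℕ} (a b : Fin w) (j : Fin l) :
    IsLineInterval (Finset.Icc a b ×ˢ {j}) :=
  Or.inr ⟨a, b, j, rfl⟩

theorem isLineInterval_univ_product {w l : ℕ} [NeZero w] (j : Fin l) :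
    IsLineInterval ((Finset.univ : Finset (Fin w)) ×ˢ {j}) :=
  Or.inr ⟨⊥, ⊤, j, by rw [Finset.Icc_bot_top]⟩

namespace Wiring

variable {I : Type} {w l : ℕ}

/-- Horizontal wires in different rows: the `i`-th wire runs in row `r i` from column `a i` to
column `b i`. -/
def alongRow (r : I ↪ Fin w) (a b : I → Fin l) (hab : ∀ i, a i ≠ b i) :
    Wiring (Fin w × Fin l) I where
  segment i := {r i} ×ˢ Finset.uIcc (a i) (b i)
  source i := (r i, a i)
  target i := (r i, b i)
  source_mem i := by simp
  target_mem i := by simp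
  source_ne_target i h := hab i (congrArg Prod.snd h)
  disjoint _ _ hij := Finset.disjoint_product.2 <| Or.inl <|
    Finset.disjoint_singleton.2 fun h => hij (r.injective h)

/-- Vertical wires in different columns: the `i`-th wire runs in column `c i` from row `a i` to
row `b i`. -/
def alongColumn (c : I ↪ Fin l) (a b : I → Fin w) (hab : ∀ i, a i ≠ b i) :
    Wiring (Fin w × Fin l) I where
  segment i := Finset.uIcc (a i) (b i) ×ˢ {c i}
  source i := (a i, c i)
  target i := (b i, c i)
  source_mem i := by simp
  target_mem i := by simp
  source_ne_target i h := hab i (congrArg Prod.fst h)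
  disjoint _ _ hij := Finset.disjoint_product.2 <| Or.inr <|
    Finset.disjoint_singleton.2 fun h => hij (c.injective h)

end Wiring

end LineInterval

section Lattice

variable {V : Type} {N : ℕ} (σ : V ≃ Fin N)

/-- The placement of a register in the first column of a lattice. -/
def firstColumn : V ↪ Fin N × Fin (N + 1) :=
  ⟨fun v => (σ v, 0), fun _ _ h => σ.injective (congrArg Prod.fst h)⟩

theorem notMem_range_firstColumn {r : Fin N} {c : Fin (N + 1)} (hc : c ≠ 0) :
    (r, c) ∉ Set.range (firstColumn σ) := fun ⟨_, hv⟩ => hc (congrArg Prod.snd hv).symm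

variable [DecidableEq V] (M : CZLayer V)

/-- The column in which the gate of `M` with support `S` is performed on the lattice. Since the
gates of `M` are disjoint, the row of any qubit of `S` numbers them. -/
noncomputable def gateColumn (S : M.supports) : Fin (N + 1) :=
  (σ (M.nonempty S S.2).choose).succ

theorem gateColumn_ne_zero (S : M.supports) : gateColumn σ M S ≠ 0 := Fin.succ_ne_zero _

theorem gateColumn_injective : Function.Injective (gateColumn σ M) := fun S T h => by
  have h' := σ.injective (Fin.succ_injective _ h)
  exact Subtype.ext <| M.disjoint.elim_finset S.2 T.2 _ (M.nonempty S S.2).choose_spec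
    (h' ▸ (M.nonempty T T.2).choose_spec)

theorem mk_eq_of_mem {S T : M.supports} {v : V} (hS : v ∈ S.1) (hT : v ∈ T.1) : S = T :=
  Subtype.ext (M.disjoint.elim_finset S.2 T.2 v hS hT)

theorem row_injective : Function.Injective fun i : Σ S : M.supports, S.1 => σ i.2 := by
  rintro ⟨S, v, hS⟩ ⟨T, u, hT⟩ h
  obtain rfl : v = u := σ.injective h
  obtain rfl := mk_eq_of_mem M hS hT
  rfl

/-- The wires that copy every qubit in the support of a gate of `M` along its row, from the first
column to the column of that gate. -/
noncomputable def fanOut : Wiring (Fin N × Fin (N + 1)) (Σ S : M.supports, S.1) :=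
  .alongRow ⟨fun i => σ i.2, row_injective σ M⟩ (fun _ => 0) (fun i => gateColumn σ M i.1)
    fun i => (gateColumn_ne_zero σ M i.1).symm

theorem product_gateColumn_nonempty (S : M.supports) :
    ((Finset.univ : Finset (Fin N)) ×ˢ {gateColumn σ M S}).Nonempty :=
  ⟨(σ (M.nonempty S S.2).choose, gateColumn σ M S), by simp⟩

theorem pairwise_disjoint_product_gateColumn :
    Pairwise (Function.onFun Disjoint fun S : M.supports =>
      (Finset.univ : Finset (Fin N)) ×ˢ {gateColumn σ M S}) := fun _ _ hST =>
  Finset.disjoint_product.2 <| Or.inr <| Finset.disjoint_singleton.2 fun h =>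
    hST (gateColumn_injective σ M h)

/-- The layer with a `CZ` gate on the full column of every gate of `M`. -/
noncomputable def columnLayer : CZLayer (Fin N × Fin (N + 1)) :=
  CZLayer.ofFamily (fun S : M.supports => Finset.univ ×ˢ {gateColumn σ M S})
    (product_gateColumn_nonempty σ M) (pairwise_disjoint_product_gateColumn σ M)

theorem isLineInterval_of_mem_columnLayer :
    ∀ S ∈ (columnLayer σ M).supports, IsLineInterval S := by
  refine CZLayer.forall_mem_supports_ofFamily.2 fun S => ?_
  have : NeZero N := ⟨(σ (M.nonempty S S.2).choose).pos.ne'⟩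
  exact isLineInterval_univ_product _

open Classical in
/-- The bits at which the gates of `columnLayer` are activated: in the column of a gate of `M`,
the bit `1` marks the rows of the support. -/
noncomputable def columnPattern (p : Fin N × Fin (N + 1)) : Bool :=
  decide (∃ S : M.supports, p.2 = gateColumn σ M S ∧ σ.symm p.1 ∈ S.1)

theorem columnPattern_eq_true_iff (S : M.supports) (v : V) :
    columnPattern σ M (σ v, gateColumn σ M S) = true ↔ v ∈ S.1 := by
  simp only [columnPattern, decide_eq_true_eq, Equiv.symm_apply_apply]
  refine ⟨?_, fun hv => ⟨S, rfl, hv⟩⟩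
  rintro ⟨T, hT, hv⟩
  rwa [gateColumn_injective σ M hT]

/-- The state of the lattice after the bits of `x` in the first column have been copied by
`fanOut`. -/
noncomputable def fannedOut (x : V → Bool) : Fin N × Fin (N + 1) → Bool :=
  addBits (Function.extend (firstColumn σ) x fun _ => false) (fanOut σ M).target
    fun i => x i.2

theorem fannedOut_eq_true_iff (x : V → Bool) (S : M.supports) (v : V) :
    fannedOut σ M x (σ v, gateColumn σ M S) = true ↔ v ∈ S.1 ∧ x v = true := by
  have clean : Function.extend (firstColumn σ) x (fun _ => false) (σ v, gateColumn σ M S) =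
      false :=
    extend_apply_of_notMem_range _ _ _ (notMem_range_firstColumn σ (gateColumn_ne_zero σ M S))
  by_cases hv : v ∈ S.1
  · have h := addBits_apply (Function.extend (firstColumn σ) x fun _ => false)
      (fanOut σ M).target_injective (fun i => x i.2) ⟨S, v, hv⟩
    have h' : fannedOut σ M x (σ v, gateColumn σ M S) = x v := by
      rw [← Bool.false_xor (x v), ← clean]
      exact h
    rw [h', and_iff_right hv]
  · rw [fannedOut, addBits_of_ne _ _ ?_, clean]
    · simp [hv]
    · rintro ⟨T, u, hu⟩ h
      obtain ⟨hrow, hcol⟩ := Prod.mk.inj h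
      obtain rfl : v = u := σ.injective hrow
      obtain rfl := gateColumn_injective σ M hcol
      exact hv hu

theorem fanOut_copy_mulVec_ket (x : V → Bool) :
    (fanOut σ M).copy *ᵥ ket (Function.extend (firstColumn σ) x fun _ => false) =
      ket (fannedOut σ M x) := by
  rw [Wiring.copy_mulVec_ket]
  · exact congrArg (fun b => ket (addBits _ _ b))
      (funext fun i => (firstColumn σ).injective.extend_apply x _ i.2.1)
  · rintro i ⟨r, c⟩ hv hs -
    refine extend_apply_of_notMem_range _ _ _ (notMem_range_firstColumn σ ?_)
    rintro rfl
    obtain rfl : r = σ i.2 := Finset.mem_singleton.1 (Finset.mem_product.1 hv).1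
    exact hs rfl

variable [Fintype V]

theorem columnLayer_sign_fannedOut (x : V → Bool) :
    (columnLayer σ M).sign (fun p => fannedOut σ M x p == columnPattern σ M p) = M.sign x := by
  rw [columnLayer, CZLayer.sign_ofFamily, CZLayer.sign, ← Finset.prod_coe_sort M.supports]
  refine Finset.prod_congr rfl fun S _ => if_congr ⟨fun h v hv => ?_, ?_⟩ rfl rfl
  · have hmatch := beq_iff_eq.1 (h (σ v, gateColumn σ M S) (by simp))
    rw [(columnPattern_eq_true_iff σ M S v).2 hv] at hmatch
    exact ((fannedOut_eq_true_iff σ M x S v).1 hmatch).2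
  · rintro h ⟨r, c⟩ hrc
    obtain rfl : c = gateColumn σ M S :=
      Finset.mem_singleton.1 (Finset.mem_product.1 hrc).2
    obtain ⟨v, rfl⟩ := σ.surjective r
    rw [beq_iff_eq, Bool.eq_iff_iff, fannedOut_eq_true_iff, columnPattern_eq_true_iff]
    exact and_iff_left_of_imp (h v)

theorem exists_lattice_czLayer :
    ∃ W : Matrix (Fin N × Fin (N + 1) → Bool) (Fin N × Fin (N + 1) → Bool) ℂ,
      Realizes IsLineInterval 3 W ∧
        W * placement (firstColumn σ) (fun _ => false) =
          placement (firstColumn σ) (fun _ => false) * M.toMatrix := by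
  have hcopy : Realizes IsLineInterval 1 (fanOut σ M).copy :=
    (fanOut σ M).realizes_copy fun i => isLineInterval_row _ _ _
  have hphase := realizes_diagonal_sign_beq (columnLayer σ M)
    (isLineInterval_of_mem_columnLayer σ M) (columnPattern σ M)
  refine ⟨_, hcopy.conjTranspose.mul (hphase.mul hcopy), matrix_ext_ket fun x => ?_⟩
  simp only [← Matrix.mulVec_mulVec, placement_mulVec_ket, M.toMatrix_eq_diagonal,
    diagonal_mulVec_ket, Matrix.mulVec_smul]
  rw [fanOut_copy_mulVec_ket, diagonal_mulVec_ket, columnLayer_sign_fannedOut,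
    Matrix.mulVec_smul, ← fanOut_copy_mulVec_ket,
    conjTranspose_mulVec_mulVec_of_unitary hcopy.mem_unitaryGroup]

theorem Realizes.exists_lattice_simulation {P : Finset V → Prop} {d : ℕ}
    {A : Matrix (V → Bool) (V → Bool) ℂ} (hA : Realizes P d A) :
    ∃ W : Matrix (Fin N × Fin (N + 1) → Bool) (Fin N × Fin (N + 1) → Bool) ℂ,
      Realizes IsLineInterval (3 * d) W ∧
        W * placement (firstColumn σ) (fun _ => false) =
          placement (firstColumn σ) (fun _ => false) * A := by
  induction hA with
  | single L =>
    refine ⟨_, ?_, extendUnitary_mul_placement _ (singleQubitLayer L) _⟩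
    rw [extendUnitary, parallel_singleQubitLayer]
    exact .single _
  | cz M _ => exact exists_lattice_czLayer σ M
  | mul _ _ h₁ h₂ =>
    obtain ⟨W₁, hW₁, h₁⟩ := h₁
    obtain ⟨W₂, hW₂, h₂⟩ := h₂
    refine ⟨W₁ * W₂, mul_add 3 _ _ ▸ hW₁.mul hW₂, ?_⟩
    rw [Matrix.mul_assoc, h₂, ← Matrix.mul_assoc, h₁, Matrix.mul_assoc]

end Lattice

theorem ComputesParity.of_placement {V V' J : Type} [Fintype V] [DecidableEq V] [Fintype V']
    [DecidableEq V'] [Fintype J] {A : Matrix (V → Bool) (V → Bool) ℂ}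
    {W : Matrix (V' → Bool) (V' → Bool) ℂ} (e : V ↪ V')
    (hW : W * placement e (fun _ => false) = placement e (fun _ => false) * A)
    {inp : J → V} {tgt : V} (hA : ComputesParity A inp tgt) :
    ComputesParity W (fun j => e (inp j)) (e tgt) := by
  intro x hx
  have clean (v) (hv : v ∉ Set.range e) : x v = false :=
    hx v (fun j h => hv ⟨_, h.symm⟩) fun h => hv ⟨_, h.symm⟩
  have hA' := hA (fun u => x (e u)) fun u hu hut =>
    hx _ (fun j h => hu j (e.injective h)) fun h => hut (e.injective h)
  have hW' := congrArg (· *ᵥ ket fun u => x (e u)) hW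
  simp only [← Matrix.mulVec_mulVec, hA', placement_mulVec_ket] at hW'
  have before : x = Function.extend e (fun u => x (e u)) fun _ => false :=
    (eq_extend_iff e).2 ⟨fun _ => rfl, clean⟩
  conv_lhs => rw [before]
  conv_rhs => rw [before, update_extend, e.injective.extend_apply]
  simpa only [e.injective.extend_apply] using hW'

/-! ### Composition of parity circuits -/

theorem odd_toNat_iff (b : Bool) : Odd b.toNat ↔ b = true := by cases b <;> decide

theorem parityOf_eq_true_iff {K : Type} [Fintype K] (x : K → Bool) :
    parityOf x = true ↔ Odd (∑ k, (x k).toNat) := by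
  simp only [parityOf, decide_eq_true_eq, Finset.odd_sum_iff_odd_card_odd, odd_toNat_iff]

theorem parityOf_prod {I J : Type} [Fintype I] [Fintype J] (x : I × J → Bool) :
    parityOf x = parityOf fun i => parityOf fun j => x (i, j) := by
  rw [Bool.eq_iff_iff, parityOf_eq_true_iff, parityOf_eq_true_iff, Fintype.sum_prod_type,
    Finset.odd_sum_iff_odd_card_odd, Finset.odd_sum_iff_odd_card_odd]
  simp only [odd_toNat_iff, parityOf_eq_true_iff]

theorem parityOf_comp_injective {I J : Type} [Fintype I] [Fintype J] {g : I → J}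
    (hg : Function.Injective g) {x : J → Bool} (hx : ∀ j ∉ Set.range g, x j = false) :
    (parityOf fun i => x (g i)) = parityOf x := by
  rw [Bool.eq_iff_iff, parityOf_eq_true_iff, parityOf_eq_true_iff,
    Fintype.sum_of_injective g hg _ (fun j => (x j).toNat) (fun j hj => ?_) fun _ => rfl]
  rw [hx j hj, Bool.toNat_false]

theorem ComputesParity.comp_injective {V I J : Type} [Fintype V] [DecidableEq V] [Fintype I]
    [Fintype J] {A : Matrix (V → Bool) (V → Bool) ℂ} {inp : J → V} {tgt : V}
    (hA : ComputesParity A inp tgt) (hinp : Function.Injective inp) (htgt : ∀ j, inp j ≠ tgt)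
    {g : I → J} (hg : Function.Injective g) : ComputesParity A (fun i => inp (g i)) tgt := by
  intro x hx
  have idle (j) (hj : j ∉ Set.range g) : x (inp j) = false :=
    hx _ (fun i h => hj ⟨i, (hinp h).symm⟩) (htgt j)
  rw [parityOf_comp_injective hg idle]
  exact hA x fun v hv => hx v fun i => hv (g i)

section Composition

variable {V Vb V₀ I J : Type} [Fintype V] [DecidableEq V]

theorem ComputesParity.parallel_mulVec_ket [Fintype I] [Fintype J] [Fintype Vb]
    [DecidableEq Vb] {A : Matrix (Vb → Bool) (Vb → Bool) ℂ} {inp : J → Vb} {tgt : Vb}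
    (hA : ComputesParity A inp tgt) (e : I × Vb ↪ V) {x : V → Bool}
    (hx : ∀ i v, (∀ j, v ≠ inp j) → v ≠ tgt → x (e (i, v)) = false) :
    parallel e A *ᵥ ket x =
      ket (addBits x (fun i => e (i, tgt)) fun i => parityOf fun j => x (e (i, inp j))) := by
  have e_injective : Function.Injective fun i => e (i, tgt) := fun i j h =>
    congrArg Prod.fst (e.injective h)
  refine _root_.parallel_mulVec_ket e (fun i => ?_) fun v hv =>
    (addBits_of_ne _ _ fun i h => hv ⟨_, h.symm⟩).symm
  rw [hA _ (hx i)]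
  congr 1
  ext v
  by_cases hv : v = tgt
  · subst hv
    rw [Function.update_self]
    exact (addBits_apply x e_injective (fun i => parityOf fun j => x (e (i, inp j))) i).symm
  · rw [Function.update_of_ne hv, addBits_of_ne]
    exact fun k h => hv (congrArg Prod.snd (e.injective h))

theorem ComputesParity.extendUnitary_mulVec_ket [Fintype I] [Fintype V₀] [DecidableEq V₀]
    {B : Matrix (V₀ → Bool) (V₀ → Bool) ℂ} {inp : I → V₀} {tgt : V₀}
    (hB : ComputesParity B inp tgt) (e : V₀ ↪ V) {x : V → Bool}
    (hx : ∀ v, (∀ i, v ≠ inp i) → v ≠ tgt → x (e v) = false) :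
    extendUnitary e B *ᵥ ket x =
      ket (Function.update x (e tgt) (xor (x (e tgt)) (parityOf fun i => x (e (inp i))))) := by
  refine _root_.parallel_mulVec_ket _ (fun _ => ?_) fun v hv => ?_
  · refine (hB _ hx).trans (congrArg ket (funext fun v => ?_))
    change _ = Function.update x (e tgt) _ (e v)
    simp only [Function.update_apply, e.injective.eq_iff]
  · rw [Function.update_of_ne]
    rintro rfl
    exact hv ⟨((), tgt), rfl⟩

theorem ComputesParity.of_uncompute [Fintype J] {U B : Matrix (V → Bool) (V → Bool) ℂ}
    {inp : J → V} {tgt : V} {s : (V → Bool) → V → Bool}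
    (hU : U ∈ Matrix.unitaryGroup (V → Bool) ℂ)
    (hUs : ∀ x : V → Bool, (∀ v, (∀ j, v ≠ inp j) → v ≠ tgt → x v = false) →
      U *ᵥ ket x = ket (s x) ∧ B *ᵥ ket (s x) =
        ket (Function.update (s x) tgt (xor (x tgt) (parityOf fun j => x (inp j)))))
    (hs : ∀ x b, s (Function.update x tgt b) = Function.update (s x) tgt b) :
    ComputesParity (Uᴴ * (B * U)) inp tgt := by
  intro x hx
  set b := xor (x tgt) (parityOf fun j => x (inp j))
  have hx' (v) (hv : ∀ j, v ≠ inp j) (ht : v ≠ tgt) : Function.update x tgt b v = false := by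
    rw [Function.update_of_ne ht, hx v hv ht]
  rw [← Matrix.mulVec_mulVec, ← Matrix.mulVec_mulVec, (hUs x hx).1, (hUs x hx).2, ← hs,
    ← (hUs _ hx').1, conjTranspose_mulVec_mulVec_of_unitary hU]

end Composition

section TreeLayout

variable {V Vb V₀ I J : Type}

/-- A layout for the composition of parity circuits: the register `V` contains copies
`block (i, ·)` of a register with inputs `inp` and target `tgt`, and a register `root` with inputs
`inp₀` and target `tgt₀`. The wires `fst` and then `snd` take the bit at the target of the `i`-th
block to the `i`-th input of the root. -/
structure TreeLayout (V : Type) (inp : J → Vb) (tgt : Vb) (inp₀ : I → V₀) (tgt₀ : V₀) where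
  block : I × Vb ↪ V
  root : V₀ ↪ V
  fst : Wiring V I
  snd : Wiring V I
  fst_source : fst.source = fun i => block (i, tgt)
  snd_source : snd.source = fst.target
  snd_target : snd.target = fun i => root (inp₀ i)
  block_ne_root : ∀ p v, block p ≠ root v
  fst_target_ne_root : ∀ i v, fst.target i ≠ root v
  block_input_notMem_fst : ∀ k j i, block (k, inp j) ∉ fst.segment i
  block_notMem_snd : ∀ p i, block p ∉ snd.segment i
  root_target_notMem_fst : ∀ i, root tgt₀ ∉ fst.segment i
  root_target_notMem_snd : ∀ i, root tgt₀ ∉ snd.segment i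

namespace TreeLayout

variable {inp : J → Vb} {tgt : Vb} {inp₀ : I → V₀} {tgt₀ : V₀}

variable (T : TreeLayout V inp tgt inp₀ tgt₀)

/-- The basis states in which all qubits are `0`, except the inputs of the blocks and the target
of the root. -/
def IsClean (x : V → Bool) : Prop :=
  ∀ v, (∀ p : I × J, v ≠ T.block (p.1, inp p.2)) → v ≠ T.root tgt₀ → x v = false

variable {T} in
theorem IsClean.apply_of_mem_fst {x : V → Bool} (hx : T.IsClean x) {i : I} {v : V}
    (hv : v ∈ T.fst.segment i) : x v = false :=
  hx v (fun p h => T.block_input_notMem_fst p.1 p.2 i (h ▸ hv))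
    fun h => T.root_target_notMem_fst i (h ▸ hv)

variable {T} in
theorem IsClean.apply_of_mem_snd {x : V → Bool} (hx : T.IsClean x) {i : I} {v : V}
    (hv : v ∈ T.snd.segment i) : x v = false :=
  hx v (fun _ h => T.block_notMem_snd _ i (h ▸ hv))
    fun h => T.root_target_notMem_snd i (h ▸ hv)

theorem root_target_ne_fst_source (i : I) : T.root tgt₀ ≠ T.fst.source i := fun h =>
  T.root_target_notMem_fst i (h ▸ T.fst.source_mem i)

theorem root_target_ne_snd_target (i : I) : T.root tgt₀ ≠ T.snd.target i := fun h =>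
  T.root_target_notMem_snd i (h ▸ T.snd.target_mem i)

variable [Fintype J]

/-- The parities of the inputs of the blocks. -/
def parities (x : V → Bool) (i : I) : Bool := parityOf fun j => x (T.block (i, inp j))

/-- The state `x` after the parities of the blocks have been added to the targets of the blocks,
and copied along the wires to the inputs of the root. -/
noncomputable def spreadState (x : V → Bool) : V → Bool :=
  addBits (addBits (addBits x T.fst.source (T.parities x)) T.fst.target (T.parities x))
    T.snd.target (T.parities x)

theorem spreadState_root_of_ne (x : V → Bool) {v : V₀}
    (hv : ∀ i, T.root v ≠ T.snd.target i) : T.spreadState x (T.root v) = x (T.root v) := by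
  rw [spreadState, addBits_of_ne _ _ hv,
    addBits_of_ne _ _ fun i h => T.fst_target_ne_root i v h.symm, addBits_of_ne]
  simp only [T.fst_source]
  exact fun i h => T.block_ne_root _ _ h.symm

theorem spreadState_root_input {x : V → Bool} (hx : T.IsClean x) (i : I) :
    T.spreadState x (T.root (inp₀ i)) = T.parities x i := by
  have hi : T.root (inp₀ i) = T.snd.target i := (congrFun T.snd_target i).symm
  rw [spreadState, hi, addBits_apply _ T.snd.target_injective,
    addBits_of_ne _ _ fun k h => ?_, addBits_of_ne _ _ fun k h => ?_,
    hx.apply_of_mem_snd (T.snd.target_mem i), Bool.false_xor]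
  · exact T.block_ne_root _ _ ((congrFun T.fst_source k).symm.trans (h.symm.trans hi.symm))
  · exact T.fst_target_ne_root k _ (h.symm.trans hi.symm)

theorem spreadState_update [DecidableEq V] (x : V → Bool) (b : Bool) :
    T.spreadState (Function.update x (T.root tgt₀) b) =
      Function.update (T.spreadState x) (T.root tgt₀) b := by
  have parities_update : T.parities (Function.update x (T.root tgt₀) b) = T.parities x := by
    ext i
    simp only [parities, Function.update_of_ne (T.block_ne_root _ _)]
  rw [spreadState, parities_update, addBits_update _ _ T.root_target_ne_fst_source,
    addBits_update _ _ fun i h => T.fst_target_ne_root i _ h.symm,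
    addBits_update _ _ T.root_target_ne_snd_target, spreadState]

variable [Fintype V] [DecidableEq V] [Fintype I]

theorem spread_mulVec_ket [Fintype Vb] [DecidableEq Vb]
    {A : Matrix (Vb → Bool) (Vb → Bool) ℂ} (hA : ComputesParity A inp tgt)
    {x : V → Bool} (hx : T.IsClean x) :
    (T.snd.copy * (T.fst.copy * parallel T.block A)) *ᵥ ket x = ket (T.spreadState x) := by
  have blocks : parallel T.block A *ᵥ ket x = ket (addBits x T.fst.source (T.parities x)) := by
    rw [hA.parallel_mulVec_ket T.block fun i v hv _ => ?_, T.fst_source]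
    · rfl
    · refine hx _ (fun p h => hv p.2 ?_) (T.block_ne_root _ _)
      exact congrArg Prod.snd (T.block.injective h)
  rw [← Matrix.mulVec_mulVec, ← Matrix.mulVec_mulVec, blocks,
    T.fst.copy_mulVec_ket_addBits fun i v hv => hx.apply_of_mem_fst hv, ← T.snd_source,
    T.snd.copy_mulVec_ket_addBits fun i v hv => ?_, spreadState, T.snd_source]
  rw [addBits_of_ne, hx.apply_of_mem_snd hv]
  rintro k rfl
  exact T.block_notMem_snd _ i (congrFun T.fst_source k ▸ hv)

theorem root_mulVec_ket_spreadState [Fintype V₀] [DecidableEq V₀]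
    {B : Matrix (V₀ → Bool) (V₀ → Bool) ℂ} (hB : ComputesParity B inp₀ tgt₀)
    {x : V → Bool} (hx : T.IsClean x) :
    extendUnitary T.root B *ᵥ ket (T.spreadState x) =
      ket (Function.update (T.spreadState x) (T.root tgt₀) (xor (x (T.root tgt₀))
        (parityOf fun p : I × J => x (T.block (p.1, inp p.2))))) := by
  rw [hB.extendUnitary_mulVec_ket T.root fun v hv ht => ?_]
  · simp only [T.spreadState_root_of_ne x T.root_target_ne_snd_target,
      T.spreadState_root_input hx, parityOf_prod fun p : I × J => x (T.block (p.1, inp p.2))]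
    rfl
  · rw [T.spreadState_root_of_ne, hx _ (fun p h => T.block_ne_root _ _ h.symm)
      fun h => ht (T.root.injective h)]
    simp only [T.snd_target]
    exact fun i h => hv i (T.root.injective h)

theorem exists_computesParity [Fintype Vb] [DecidableEq Vb] [Fintype V₀] [DecidableEq V₀]
    {P : Finset V → Prop} {Pb : Finset Vb → Prop} {P₀ : Finset V₀ → Prop}
    (hblock : ∀ i S, Pb S → P (S.map ((Function.Embedding.sectR i Vb).trans T.block)))
    (hroot : ∀ S, P₀ S → P (S.map T.root))
    (hfst : ∀ i, P (T.fst.segment i)) (hsnd : ∀ i, P (T.snd.segment i))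
    {d d₀ : ℕ} {A : Matrix (Vb → Bool) (Vb → Bool) ℂ} (hA : Realizes Pb d A)
    (hAp : ComputesParity A inp tgt) {B : Matrix (V₀ → Bool) (V₀ → Bool) ℂ}
    (hB : Realizes P₀ d₀ B) (hBp : ComputesParity B inp₀ tgt₀) :
    ∃ K, Realizes P (2 * (d + 2) + d₀) K ∧
      ComputesParity K (fun p : I × J => T.block (p.1, inp p.2)) (T.root tgt₀) := by
  have hU : Realizes P (1 + (1 + d)) (T.snd.copy * (T.fst.copy * parallel T.block A)) :=
    (T.snd.realizes_copy hsnd).mul ((T.fst.realizes_copy hfst).mul (hA.parallel _ hblock))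
  have hK := hU.conjTranspose.mul ((hB.extend _ hroot).mul hU)
  rw [show 1 + (1 + d) + (d₀ + (1 + (1 + d))) = 2 * (d + 2) + d₀ by ring] at hK
  exact ⟨_, hK, .of_uncompute hU.mem_unitaryGroup
    (fun x hx => ⟨T.spread_mulVec_ket hAp hx, T.root_mulVec_ket_spreadState hBp hx⟩)
    T.spreadState_update⟩

end TreeLayout

end TreeLayout

/-! ### Composition on a lattice -/

section LineInterval

theorem IsLineInterval.map_prodMap {w l w' l' : ℕ} {f : Fin w ↪ Fin w'} {g : Fin l ↪ Fin l'}
    (hf : ∀ a b, (Finset.Icc a b).map f = Finset.Icc (f a) (f b))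
    (hg : ∀ a b, (Finset.Icc a b).map g = Finset.Icc (g a) (g b)) {S : Finset (Fin w × Fin l)}
    (hS : IsLineInterval S) : IsLineInterval (S.map (f.prodMap g)) := by
  obtain ⟨i, a, b, rfl⟩ | ⟨a, b, j, rfl⟩ := hS
  · rw [Finset.prodMap_map_product, Finset.map_singleton, hg]
    exact isLineInterval_row _ _ _
  · rw [Finset.prodMap_map_product, Finset.map_singleton, hf]
    exact isLineInterval_column _ _ _

theorem map_sectR_finProdFinEquiv_Icc {m l : ℕ} (i : Fin m) (a b : Fin l) :
    (Finset.Icc a b).map ((Function.Embedding.sectR i (Fin l)).trans finProdFinEquiv.toEmbedding) =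
      Finset.Icc (finProdFinEquiv (i, a)) (finProdFinEquiv (i, b)) := by
  ext v
  simp only [Finset.mem_map, Finset.mem_Icc, Function.Embedding.trans_apply,
    Function.Embedding.sectR_apply, Equiv.toEmbedding_apply, Fin.le_def, Fin.ext_iff,
    finProdFinEquiv_apply_val]
  constructor
  · rintro ⟨c, hc, hv⟩
    omega
  · rintro ⟨ha, hb⟩
    exact ⟨⟨v - l * i, by omega⟩, by dsimp only; omega⟩

end LineInterval

namespace TreeLayout

variable {V Vb V₀ I J : Type} {inp : J → Vb} {tgt : Vb} {inp₀ : I → V₀} {tgt₀ : V₀}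

theorem sumElim_injective (T : TreeLayout V inp tgt inp₀ tgt₀) (hinp : Function.Injective inp) :
    Function.Injective
      (Sum.elim (fun p : I × J => T.block (p.1, inp p.2)) fun _ : Unit => T.root tgt₀) :=
  Function.Injective.sumElim
    (fun _ _ h => Function.injective_id.prodMap hinp (T.block.injective h))
    (Function.injective_of_subsingleton _) fun _ _ => T.block_ne_root _ _

end TreeLayout

section LatticeLayout

variable {m N n w l : ℕ}

theorem castAdd_lt_natAdd (a : Fin w) (b : Fin N) : Fin.castAdd N a < Fin.natAdd w b :=
  Fin.lt_def.2 (a.isLt.trans_le (Nat.le_add_right _ _))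

/-- The columns of the `m` blocks in the layout of `latticeLayout`: the first `N + 1` columns are
those of the root, and the blocks stand side by side to the right of them. -/
def blockColumn : Fin m × Fin l ↪ Fin (N + 1 + m * l) :=
  finProdFinEquiv.toEmbedding.trans (Fin.natAddEmb (N + 1))

theorem castAdd_ne_blockColumn (c : Fin (N + 1)) (p : Fin m × Fin l) :
    Fin.castAdd (m * l) c ≠ blockColumn p :=
  (castAdd_lt_natAdd c _).ne

/-- The layout on a lattice of `m` parity circuits on `w × l` lattices and a root circuit on an
`N × (N + 1)` lattice whose input qubits are in its first column. The blocks stand side by side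
above and to the right of the root; the parity of a block travels down the column of its target,
and then along the row of the corresponding input qubit of the root. -/
def latticeLayout (row : Fin m ⊕ Unit ↪ Fin N) (ι : Fin n ⊕ Unit ↪ Fin w × Fin l)
    (hι : (ι (Sum.inr ())).1.val + 1 = w) :
    TreeLayout (Fin (w + N) × Fin (N + 1 + m * l)) (fun j => ι (Sum.inl j)) (ι (Sum.inr ()))
      (fun i => (row (Sum.inl i), (0 : Fin (N + 1)))) (row (Sum.inr ()), 0) where
  block := ⟨fun p => (Fin.castAdd N p.2.1, blockColumn (p.1, p.2.2)), fun p q h => by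
    obtain ⟨hrow, hcol⟩ := Prod.mk.inj h
    obtain ⟨hi, hc⟩ := Prod.mk.inj (blockColumn.injective hcol)
    exact Prod.ext hi (Prod.ext (Fin.castAdd_injective _ _ hrow) hc)⟩
  root := (Fin.natAddEmb w).prodMap (Fin.castAddEmb (m * l))
  fst := .alongColumn ⟨fun i => blockColumn (i, (ι (Sum.inr ())).2), fun i j h =>
      congrArg Prod.fst (blockColumn.injective h)⟩
    (fun _ => Fin.castAdd N (ι (Sum.inr ())).1) (fun i => Fin.natAdd w (row (Sum.inl i)))
    fun _ => (castAdd_lt_natAdd _ _).ne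
  snd := .alongRow (.trans (.trans .inl row) (Fin.natAddEmb w))
    (fun i => blockColumn (i, (ι (Sum.inr ())).2)) (fun _ => Fin.castAdd (m * l) 0)
    fun _ => (castAdd_ne_blockColumn _ _).symm
  fst_source := rfl
  snd_source := rfl
  snd_target := rfl
  block_ne_root _ _ h := (castAdd_lt_natAdd _ _).ne (congrArg Prod.fst h)
  fst_target_ne_root _ _ h := castAdd_ne_blockColumn _ _ (congrArg Prod.snd h).symm
  block_input_notMem_fst k j i h := by
    obtain ⟨hrow, hcol⟩ := Finset.mem_product.1 h
    have hc := congrArg Prod.snd (blockColumn.injective (Finset.mem_singleton.1 hcol))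
    rw [Finset.uIcc_of_le (castAdd_lt_natAdd _ _).le, Finset.mem_Icc, Fin.le_def] at hrow
    have hr : (ι (Sum.inl j)).1 = (ι (Sum.inr ())).1 :=
      Fin.ext (le_antisymm (by omega) hrow.1)
    exact Sum.inl_ne_inr (ι.injective (Prod.ext hr hc))
  block_notMem_snd p i h :=
    (castAdd_lt_natAdd _ _).ne (Finset.mem_singleton.1 (Finset.mem_product.1 h).1)
  root_target_notMem_fst i h :=
    castAdd_ne_blockColumn _ _ (Finset.mem_singleton.1 (Finset.mem_product.1 h).2)
  root_target_notMem_snd i h := by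
    have h' := Fin.natAdd_injective _ _ (Finset.mem_singleton.1 (Finset.mem_product.1 h).1)
    exact Sum.inr_ne_inl (row.injective h')

theorem isLineInterval_map_block {row : Fin m ⊕ Unit ↪ Fin N}
    {ι : Fin n ⊕ Unit ↪ Fin w × Fin l} {hι : (ι (Sum.inr ())).1.val + 1 = w} (i : Fin m)
    {S : Finset (Fin w × Fin l)} (hS : IsLineInterval S) : IsLineInterval
      (S.map ((Function.Embedding.sectR i _).trans (latticeLayout row ι hι).block)) := by
  refine hS.map_prodMap (f := Fin.castAddEmb N)
    (g := ((Function.Embedding.sectR i (Fin l)).trans finProdFinEquiv.toEmbedding).trans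
      (Fin.natAddEmb (N + 1))) (Fin.map_castAddEmb_Icc N) fun a b => ?_
  rw [← Finset.map_map, map_sectR_finProdFinEquiv_Icc, Fin.map_natAddEmb_Icc]
  rfl

theorem isLineInterval_map_root {row : Fin m ⊕ Unit ↪ Fin N}
    {ι : Fin n ⊕ Unit ↪ Fin w × Fin l} {hι : (ι (Sum.inr ())).1.val + 1 = w}
    {S : Finset (Fin N × Fin (N + 1))} (hS : IsLineInterval S) :
    IsLineInterval (S.map (latticeLayout row ι hι).root) :=
  hS.map_prodMap (Fin.map_natAddEmb_Icc w) (Fin.map_castAddEmb_Icc (m * l))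

end LatticeLayout

/-- There is a 2D circuit of depth `d` on `w` rows of length `l` that computes the parity of `n`
qubits. The target qubit is in the last row, from where the parity can leave the lattice without
meeting an input qubit. -/
def LatticeParity (n w l d : ℕ) : Prop :=
  ∃ (A : Matrix (Fin w × Fin l → Bool) (Fin w × Fin l → Bool) ℂ)
    (ι : Fin n ⊕ Unit ↪ Fin w × Fin l), Realizes IsLineInterval d A ∧
      ComputesParity A (fun i => ι (Sum.inl i)) (ι (Sum.inr ())) ∧
      (ι (Sum.inr ())).1.val + 1 = w

/-- There is a parity circuit as in `LatticeParity`, on `N` rows of length `N + 1`, whose input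
and target qubits are in the first column. -/
def ColumnParity (m N d : ℕ) : Prop :=
  ∃ (A : Matrix (Fin N × Fin (N + 1) → Bool) (Fin N × Fin (N + 1) → Bool) ℂ)
    (row : Fin m ⊕ Unit ↪ Fin N), Realizes IsLineInterval d A ∧
      ComputesParity A (fun i => (row (Sum.inl i), 0)) (row (Sum.inr ()), 0) ∧
      (row (Sum.inr ())).val + 1 = N

/-- There is a 2D-QAC circuit of depth at most `d` on `w` rows of length `l` that exactly
implements the parity unitary on `n + 1` qubits. -/
def HasTwoDimCircuit (n w l d : ℕ) : Prop :=
  ∃ (C : QACCircuit (Fin w × Fin l)) (ι : Fin n ⊕ Unit ↪ Fin w × Fin l),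
    C.IsTwoDim ∧ C.depth ≤ d ∧ ExactlyImplements C ι (parityUnitary n)

section Recursion

variable {m N n w l d d₀ : ℕ}

theorem ColumnParity.latticeParity (h : ColumnParity m N d) : LatticeParity m N (N + 1) d :=
  let ⟨A, row, hA, hAp, hrow⟩ := h
  ⟨A, row.trans (.sectL _ 0), hA, hAp, hrow⟩

theorem ColumnParity.compose (hB : ColumnParity m N d₀) (hA : LatticeParity n w l d) :
    LatticeParity (m * n) (w + N) (N + 1 + m * l) (2 * (d + 2) + d₀) := by
  obtain ⟨A, ι, hA, hAp, hι⟩ := hA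
  obtain ⟨B, row, hB, hBp, hrow⟩ := hB
  let T := latticeLayout row ι hι
  obtain ⟨K, hK, hKp⟩ := T.exists_computesParity (fun i S => isLineInterval_map_block i)
    (fun S => isLineInterval_map_root) (fun i => isLineInterval_column _ _ _)
    (fun i => isLineInterval_row _ _ _) hA hAp hB hBp
  have position_injective := T.sumElim_injective fun i j h => Sum.inl_injective (ι.injective h)
  have hKp' := hKp.comp_injective (position_injective.comp Sum.inl_injective)
    (fun _ => T.block_ne_root _ _) finProdFinEquiv.symm.injective
  refine ⟨K, .trans (finProdFinEquiv.symm.toEmbedding.sumMap (.refl Unit))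
    ⟨_, position_injective⟩, hK, hKp', ?_⟩
  change w + (row (Sum.inr ())).val + 1 = w + N
  rw [add_assoc, hrow]

theorem exists_latticeParity_pow (d₀ k : ℕ) : ∃ d, ∀ m N, 1 ≤ m → ColumnParity m N d₀ →
    ∃ l, l ≤ (k + 1) * m ^ (k + 1) * (N + 1) ∧
      LatticeParity (m ^ (k + 1)) ((k + 1) * N) l d := by
  induction k with
  | zero =>
    refine ⟨d₀, fun m N hm B => ⟨N + 1, ?_, ?_⟩⟩
    · simpa using Nat.le_mul_of_pos_left (N + 1) hm
    · simpa using B.latticeParity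
  | succ k ih =>
    obtain ⟨d, hd⟩ := ih
    refine ⟨2 * (d + 2) + d₀, fun m N hm B => ?_⟩
    obtain ⟨l, hl, hA⟩ := hd m N hm B
    refine ⟨N + 1 + m * l, ?_, ?_⟩
    · have h1 : 1 ≤ m ^ (k + 1 + 1) := Nat.one_le_pow _ _ hm
      calc N + 1 + m * l ≤ 1 * (N + 1) + m * ((k + 1) * m ^ (k + 1) * (N + 1)) := by
            rw [one_mul]; gcongr
        _ ≤ m ^ (k + 1 + 1) * (N + 1) + m * ((k + 1) * m ^ (k + 1) * (N + 1)) := by gcongr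
        _ = (k + 1 + 1) * m ^ (k + 1 + 1) * (N + 1) := by ring
    · simpa only [← pow_succ', ← Nat.succ_mul] using B.compose hA

theorem exists_columnParity {p : ℝ} (hp : 1 / 2 < p) (C : QAC0Family)
    (hC : ∀ n, SolvesApproxClean p (C.circuit n) Function.Embedding.inl (parityUnitary n)) :
    ∃ d, ∀ n, ColumnParity n (2 * n + C.ancillas n + 4) d := by
  obtain ⟨d, hd⟩ := C.exists_computesParity hp hC
  refine ⟨3 * d, fun n => ?_⟩
  obtain ⟨B, hB, hBp⟩ := hd n
  have card_register : Fintype.card (ParityRegister n (C.ancillas n)) =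
      2 * n + C.ancillas n + 3 + 1 := by
    simp only [ParityRegister, Fintype.card_sum, Fintype.card_fin, Fintype.card_unit,
      Fintype.card_bool]
    ring
  let σ₀ := Fintype.equivFinOfCardEq card_register
  let σ := σ₀.trans (Equiv.swap (σ₀ (Sum.inr (Sum.inr ()))) (Fin.last _))
  obtain ⟨W, hW, hWB⟩ := hB.exists_lattice_simulation σ
  have target_last : σ (Sum.inr (Sum.inr ())) = Fin.last _ := Equiv.swap_apply_left _ _
  exact ⟨W, Function.Embedding.inr.trans σ.toEmbedding, hW, hBp.of_placement _ hWB,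
    congrArg (·.val + 1) target_last⟩

theorem parityUnitary_mulVec_ket {n : ℕ} (y : Fin n ⊕ Unit → Bool) :
    parityUnitary n *ᵥ ket y = ket (Function.update y (Sum.inr ())
      (xor (y (Sum.inr ())) (parityOf fun i => y (Sum.inl i)))) := by
  ext z
  rw [mulVec_ket, ket_apply]
  refine if_congr (Eq.congr_right ?_) rfl rfl
  ext (i | _)
  · rw [Function.update_of_ne Sum.inl_ne_inr, Sum.elim_inl]
  · rw [Function.update_self]
    rfl

theorem ComputesParity.mul_placement {V : Type} [Fintype V] [DecidableEq V]
    {A : Matrix (V → Bool) (V → Bool) ℂ} {ι : Fin n ⊕ Unit ↪ V}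
    (hA : ComputesParity A (fun i => ι (Sum.inl i)) (ι (Sum.inr ()))) :
    A * placement ι (fun _ => false) = placement ι (fun _ => false) * parityUnitary n := by
  refine matrix_ext_ket fun y => ?_
  rw [← Matrix.mulVec_mulVec, ← Matrix.mulVec_mulVec, parityUnitary_mulVec_ket,
    placement_mulVec_ket, placement_mulVec_ket, hA _ ?_, update_extend]
  · simp only [ι.injective.extend_apply]
  · refine fun v hv hvt => extend_apply_of_notMem_range _ _ _ ?_
    rintro ⟨i | _, rfl⟩
    exacts [hv i rfl, hvt rfl]

theorem ComputesParity.exactlyImplements {V : Type} [Fintype V] [DecidableEq V]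
    {C : QACCircuit V} {ι : Fin n ⊕ Unit ↪ V}
    (hC : ComputesParity C.toMatrix (fun i => ι (Sum.inl i)) (ι (Sum.inr ()))) :
    ExactlyImplements C ι (parityUnitary n) := fun φ _ => by
  rw [withAncilla_eq_placement_mulVec, withAncilla_eq_placement_mulVec, Matrix.mulVec_mulVec,
    hC.mul_placement, ← Matrix.mulVec_mulVec]

theorem LatticeParity.hasTwoDimCircuit {n' w' l' : ℕ} (h : LatticeParity n w l d)
    (hn : n' ≤ n) (hw : w ≤ w') (hl : l ≤ l') : HasTwoDimCircuit n' w' l' d := by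
  obtain ⟨A, ι, hA, hAp, -⟩ := h
  let e : Fin w × Fin l ↪ Fin w' × Fin l' := (Fin.castLEEmb hw).prodMap (Fin.castLEEmb hl)
  have hE : Realizes IsLineInterval d (extendUnitary e A) := hA.extend e fun S hS =>
    hS.map_prodMap (Fin.map_castLEEmb_Icc · · hw) (Fin.map_castLEEmb_Icc · · hl)
  obtain ⟨C, hC, hd, hCA⟩ := hE.exists_circuit
  let ι' : Fin n ⊕ Unit ↪ Fin w' × Fin l' := ι.trans e
  have hEp : ComputesParity C.toMatrix (fun i => ι' (Sum.inl i)) (ι' (Sum.inr ())) :=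
    hCA ▸ hAp.of_placement e (extendUnitary_mul_placement e A _)
  refine ⟨C, ((Fin.castLEEmb hn).sumMap (.refl Unit)).trans ι', hC, hd.le,
    ComputesParity.exactlyImplements ?_⟩
  exact hEp.comp_injective (ι'.injective.comp Sum.inl_injective)
    (fun i h => Sum.inl_ne_inr (ι'.injective h)) (Fin.castLEEmb hn).injective

end Recursion

/-! ### Dimensions of the lattice -/

section Dimensions

open Filter

theorem eventually_mul_rpow_le {a b : ℝ} (hab : a < b) (K : ℝ) :
    ∀ᶠ n : ℕ in atTop, K * (n : ℝ) ^ a ≤ (n : ℝ) ^ b := by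
  have tendsto : Tendsto (fun n : ℕ => (n : ℝ) ^ (b - a)) atTop atTop :=
    (tendsto_rpow_atTop (sub_pos.2 hab)).comp tendsto_natCast_atTop_atTop
  filter_upwards [tendsto.eventually_ge_atTop K, eventually_gt_atTop 0] with n hn hpos
  calc K * (n : ℝ) ^ a ≤ (n : ℝ) ^ (b - a) * (n : ℝ) ^ a := by gcongr
    _ = (n : ℝ) ^ b := by
      rw [← Real.rpow_add (Nat.cast_pos.2 hpos), sub_add_cancel]

theorem exists_nat_root (k : ℕ) {n : ℕ} (hn : 1 ≤ n) :
    ∃ m : ℕ, 1 ≤ m ∧ n ≤ m ^ (k + 1) ∧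
      ∀ c : ℕ, (m : ℝ) ^ c ≤ 2 ^ c * (n : ℝ) ^ ((c : ℝ) / (k + 1)) := by
  set x : ℝ := (n : ℝ) ^ (1 / ((k : ℝ) + 1)) with hx
  have one_le_x : 1 ≤ x := Real.one_le_rpow (Nat.one_le_cast.2 hn) (by positivity)
  have x_pow (c : ℕ) : x ^ c = (n : ℝ) ^ ((c : ℝ) / (k + 1)) := by
    rw [hx, ← Real.rpow_natCast, ← Real.rpow_mul n.cast_nonneg, one_div_mul_eq_div]
  have le_m : x ≤ ⌈x⌉₊ := Nat.le_ceil x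
  have m_le : (⌈x⌉₊ : ℝ) ≤ 2 * x := by
    have := Nat.ceil_lt_add_one (zero_le_one.trans one_le_x)
    linarith
  refine ⟨⌈x⌉₊, Nat.one_le_ceil_iff.2 (zero_lt_one.trans_le one_le_x), ?_, fun c => ?_⟩
  · have : (n : ℝ) = x ^ (k + 1) := by
      rw [x_pow, Nat.cast_add_one, div_self (by positivity), Real.rpow_one]
    exact_mod_cast this.trans_le (pow_le_pow_left₀ (zero_le_one.trans one_le_x) le_m _)
  · rw [← x_pow, ← mul_pow]
    gcongr

theorem eventually_exists_branching {N : ℕ → ℕ} {K c : ℕ}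
    (hN : ∀ m, 1 ≤ m → N m + 1 ≤ K * m ^ c) {ε : ℝ} (hε : 0 < ε) :
    ∃ k : ℕ, ∀ᶠ n : ℕ in atTop, ∃ m, 1 ≤ m ∧ n ≤ m ^ (k + 1) ∧
      (k + 1) * N m ≤ ⌊(n : ℝ) ^ ε⌋₊ ∧
      (k + 1) * m ^ (k + 1) * (N m + 1) ≤ ⌊(n : ℝ) ^ (1 + ε)⌋₊ := by
  obtain ⟨k, hk⟩ := exists_nat_gt (c / ε)
  have exponent_lt : (c : ℝ) / (k + 1) < ε := by
    rw [div_lt_iff₀ hε] at hk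
    rw [div_lt_iff₀ (by positivity)]
    linarith
  have exponent_add : ((k + 1 + c : ℕ) : ℝ) / (k + 1) < 1 + ε := by
    rw [Nat.cast_add, Nat.cast_add_one, add_div, div_self (by positivity)]
    linarith
  refine ⟨k, ?_⟩
  filter_upwards [eventually_mul_rpow_le exponent_lt ((k + 1) * K * 2 ^ c),
    eventually_mul_rpow_le exponent_add ((k + 1) * K * 2 ^ (k + 1 + c)),
    eventually_ge_atTop 1] with n hrows hcols hn
  obtain ⟨m, hm, hnm, m_pow_le⟩ := exists_nat_root k hn
  have N_le : (N m : ℝ) + 1 ≤ K * (m : ℝ) ^ c := by exact_mod_cast hN m hm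
  refine ⟨m, hm, hnm, Nat.le_floor ?_, Nat.le_floor ?_⟩ <;> push_cast
  · calc ((k : ℝ) + 1) * N m ≤ (k + 1) * (K * (2 ^ c * (n : ℝ) ^ ((c : ℝ) / (k + 1)))) := by
          gcongr
          exact (le_add_of_nonneg_right zero_le_one).trans
            (N_le.trans (by gcongr; exact m_pow_le c))
      _ ≤ (n : ℝ) ^ ε := by simpa only [mul_assoc] using hrows
  · calc ((k : ℝ) + 1) * (m : ℝ) ^ (k + 1) * (N m + 1)
        ≤ (k + 1) * (m : ℝ) ^ (k + 1) * (K * (m : ℝ) ^ c) := by gcongr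
      _ = (k + 1) * K * (m : ℝ) ^ (k + 1 + c) := by ring
      _ ≤ (k + 1) * K * (2 ^ (k + 1 + c) * (n : ℝ) ^ (((k + 1 + c : ℕ) : ℝ) / (k + 1))) := by
          gcongr
          exact m_pow_le _
      _ ≤ (n : ℝ) ^ (1 + ε) := by simpa only [mul_assoc] using hcols

theorem exists_poly_bound {s : ℕ → ℕ} {b : ℝ}
    (h : ∀ᶠ n : ℕ in atTop, (s n : ℝ) ≤ (n : ℝ) ^ b) : ∃ c : ℕ, ∀ n, s n ≤ n ^ c + c := by
  obtain ⟨n₀, hn₀⟩ := eventually_atTop.1 h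
  refine ⟨⌈b⌉₊ + ∑ n ∈ Finset.range (n₀ + 1), s n, fun n => ?_⟩
  by_cases hn : n < n₀ + 1
  · have := Finset.single_le_sum (f := s) (fun _ _ => Nat.zero_le _) (Finset.mem_range.2 hn)
    omega
  · have one_le_n : (1 : ℝ) ≤ n := Nat.one_le_cast.2 (by omega)
    have exponent_le : b ≤ (⌈b⌉₊ + ∑ n ∈ Finset.range (n₀ + 1), s n : ℕ) :=
      (Nat.le_ceil b).trans (Nat.cast_le.2 (Nat.le_add_right _ _))
    have s_le := (hn₀ n (by omega)).trans (Real.rpow_le_rpow_of_exponent_le one_le_n exponent_le)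
    rw [Real.rpow_natCast] at s_le
    exact le_add_right (by exact_mod_cast s_le)

theorem floor_rpow_mul_floor_rpow_le (n : ℕ) {a b : ℝ} (ha : 0 < a) (hb : 0 < b) :
    ((⌊(n : ℝ) ^ a⌋₊ * ⌊(n : ℝ) ^ b⌋₊ : ℕ) : ℝ) ≤ (n : ℝ) ^ (a + b) := by
  rw [Nat.cast_mul, Real.rpow_add_of_nonneg n.cast_nonneg ha.le hb.le]
  gcongr <;> exact Nat.floor_le (by positivity)

theorem exists_twoDimQAC0Family {d : ℕ} {R L : ℕ → ℕ} {b : ℝ}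
    (hall : ∀ n, ∃ w l, HasTwoDimCircuit n w l d)
    (hRL : ∀ᶠ n in atTop, HasTwoDimCircuit n (R n) (L n) d)
    (hsize : ∀ᶠ n : ℕ in atTop, ((R n * L n : ℕ) : ℝ) ≤ (n : ℝ) ^ b) :
    ∃ D : TwoDimQAC0Family,
      (∀ n, ExactlyImplements (D.circuit n) (D.position n) (parityUnitary n)) ∧
      ∀ᶠ n in atTop, D.rows n = R n ∧ D.cols n = L n := by
  have choice (n) : ∃ w l, HasTwoDimCircuit n w l d ∧
      (HasTwoDimCircuit n (R n) (L n) d → w = R n ∧ l = L n) := by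
    by_cases h : HasTwoDimCircuit n (R n) (L n) d
    · exact ⟨_, _, h, fun _ => ⟨rfl, rfl⟩⟩
    · obtain ⟨w, l, hwl⟩ := hall n
      exact ⟨w, l, hwl, fun h' => absurd h' h⟩
  choose w l hwl dims using choice
  choose C ι htwoDim hdepth himplements using hwl
  have dims_eq := hRL.mono dims
  refine ⟨⟨w, l, C, ι, htwoDim, ⟨d, hdepth⟩, exists_poly_bound (b := b) ?_⟩, himplements,
    dims_eq⟩
  filter_upwards [hsize, dims_eq] with n hn hdim
  rwa [hdim.1, hdim.2]

theorem exists_register_bound (C : QAC0Family) :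
    ∃ K c, ∀ m, 1 ≤ m → 2 * m + C.ancillas m + 4 + 1 ≤ K * m ^ c := by
  obtain ⟨c, hc⟩ := C.poly_size
  refine ⟨c + 8, c + 1, fun m hm => ?_⟩
  have linear_le : m ≤ m ^ (c + 1) := Nat.le_self_pow c.succ_ne_zero m
  have ancillas_le : m ^ c ≤ m ^ (c + 1) := Nat.pow_le_pow_right hm c.le_succ
  have const_le : 1 ≤ m ^ (c + 1) := Nat.one_le_pow _ _ hm
  nlinarith [hc m, linear_le, ancillas_le, const_le]

end Dimensions

theorem mainTheorem4 (p : ℝ) (hp : 1 / 2 < p) (C : QAC0Family)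
    (hC : ∀ n : ℕ, SolvesApproxClean p (C.circuit n) Function.Embedding.inl (parityUnitary n))
    (ε : ℝ) (hε : 0 < ε) :
    ∃ D : TwoDimQAC0Family,
      (∀ n : ℕ, ExactlyImplements (D.circuit n) (D.position n) (parityUnitary n)) ∧
      (∀ᶠ n : ℕ in Filter.atTop,
        D.rows n = ⌊(n : ℝ) ^ ε⌋₊ ∧ D.cols n = ⌊(n : ℝ) ^ (1 + ε)⌋₊) := by
  obtain ⟨d₀, column⟩ := exists_columnParity hp C hC
  obtain ⟨K, c, size_le⟩ := exists_register_bound C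
  obtain ⟨k, branching⟩ := eventually_exists_branching size_le hε
  obtain ⟨d, lattice⟩ := exists_latticeParity_pow d₀ k
  refine exists_twoDimQAC0Family (d := d) (fun n => ?_) (branching.mono fun n => ?_)
    (.of_forall fun n => floor_rpow_mul_floor_rpow_le n hε (by positivity : 0 < 1 + ε))
  · obtain ⟨l, -, hl⟩ := lattice (n + 1) _ n.succ_pos (column (n + 1))
    have n_le : n ≤ (n + 1) ^ (k + 1) := n.le_succ.trans (Nat.le_self_pow k.succ_ne_zero _)
    exact ⟨_, l, hl.hasTwoDimCircuit n_le le_rfl le_rfl⟩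
  · rintro ⟨m, hm, n_le, rows_le, cols_le⟩
    obtain ⟨l, l_le, hl⟩ := lattice m _ hm (column m)
    exact hl.hasTwoDimCircuit n_le rows_le (l_le.trans cols_le)
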